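/- Let $C$ be an algebraically closed field (of arbitrary characteristic), let $E$ be an elliptic curve over $C$ with group law $\oplus$ and identity $\mathcal{O}$, and let $s\in E(C)$ be a non-torsion point. Let $C(E)$ be the field of rational functions on $E$, let $\nu_\alpha(f)\in\mathbb{Z}$ denote the valuation (order of vanishing) of $f\in C(E)^\times$ at $\alpha\in E(C)$, and let $\tau$ be the $C$-linear automorphism of $C(E)$ induced by the translation $\alpha\mapsto\alpha\oplus s$, i.e. $(\tau f)(\alpha)=f(\alpha\oplus s)$. Choose a representative $\alpha_\omega\in\omega$ for each orbit $\omega\in E(C)/\mathbb{Z}s$. Let $a\in C(E)^\times$. There exist $r\in C(E)^\times$ and a constant $c\in C^\times$ such that $a=c\cdot\tau(r)/r$ if and only if the following three conditions hold: (1) $\displaystyle\sum_{\alpha\in\omega}\nu_\alpha(a)=0$ for every orbit $\omega\in E(C)/\mathbb{Z}s$; (2) $\displaystyle\sum_{\omega\in E(C)/\mathbb{Z}s}\ \sum_{n\in\mathbb{Z}} n\cdot\nu_{\alpha_\omega\oplus ns}(a)=0$; (3) $\displaystyle\sum_{\omega\in E(C)/\mathbb{Z}s}\ \sum_{n\in\mathbb{Z}}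 n\cdot\nu_{\alpha_\omega\oplus ns}(a)\cdot\alpha_\omega\ \oplus\ \sum_{\omega\in E(C)/\mathbb{Z}s}\ \sum_{n\in\mathbb{Z}}\frac{n(n+1)}{2}\cdot\nu_{\alpha_\omega\oplus ns}(a)\cdot s=\mathcal{O}$, where the sums are taken in the group $E(C)$. (All sums have only finitely many nonzero terms.) -/

import Mathlib

open WeierstrassCurve WeierstrassCurve.Affine Polynomial

noncomputable section

namespace EllipticFunctions

/-! ### Order of vanishing -/

/-- The order of vanishing of `g` along the ideal `I`: the largest `n` with `g ∈ I ^ n`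
(with the conventional value `0` if there is no largest one). -/
def adicOrder {R : Type*} [CommRing R] (I : Ideal R) (g : R) : ℕ :=
  sSup {n : ℕ | g ∈ I ^ n}

/-- The order of vanishing along `I` of an element `f = g / h` of the fraction field of `R`:
the order of `g` minus the order of `h`. -/
def fracOrder {R K : Type*} [CommRing R] [IsDomain R] [Field K] [Algebra R K] [IsFractionRing R K]
    (I : Ideal R) (f : K) : ℤ :=
  (adicOrder I (IsLocalization.sec (nonZeroDivisors R) f).1 : ℤ) -
    (adicOrder I ((IsLocalization.sec (nonZeroDivisors R) f).2 : R) : ℤ)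

section Curve

variable {F : Type*} [Field F] (W : WeierstrassCurve.Affine F)

/-- The coordinate function `x` on the curve, as an element of the function field. -/
def xFun : W.FunctionField :=
  algebraMap W.CoordinateRing W.FunctionField (CoordinateRing.mk W (C X))

/-- The coordinate function `y` on the curve, as an element of the function field. -/
def yFun : W.FunctionField :=
  algebraMap W.CoordinateRing W.FunctionField (CoordinateRing.mk W X)

/-! ### The affine chart around the point at infinity -/

/-- The coordinate ring `F[x/y, 1/y]` of the affine chart `y ≠ 0` of the projective curve. The
point at infinity is the point of this chart where both `x/y` and `1/y` vanish. -/
def inftyRing : Subalgebra F W.FunctionField :=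
  Algebra.adjoin F {xFun W / yFun W, 1 / yFun W}

/-- The ideal `(x/y, 1/y)` of the point at infinity in the chart `F[x/y, 1/y]`. -/
def inftyIdeal : Ideal (inftyRing W) :=
  Ideal.span {⟨xFun W / yFun W, Algebra.subset_adjoin (by simp)⟩,
    ⟨1 / yFun W, Algebra.subset_adjoin (by simp)⟩}

theorem yFun_ne_zero : yFun W ≠ 0 := by
  rw [yFun, map_ne_zero_iff _ (IsFractionRing.injective W.CoordinateRing W.FunctionField)]
  simpa [CoordinateRing.YClass] using CoordinateRing.YClass_ne_zero (W' := W) (0 : F[X])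

theorem adjoin_xFun_yFun (g : W.CoordinateRing) :
    algebraMap W.CoordinateRing W.FunctionField g ∈ Algebra.adjoin F {xFun W, yFun W} := by
  have hp : ∀ p : F[X], algebraMap W.CoordinateRing W.FunctionField (CoordinateRing.mk W (C p)) ∈
      Algebra.adjoin F {xFun W, yFun W} := by
    intro p
    induction p using Polynomial.induction_on' with
    | add p q hp hq => rw [C_add, map_add, map_add]; exact add_mem hp hq
    | monomial n c =>
      rw [← C_mul_X_pow_eq_monomial, C_mul, C_pow, map_mul, map_mul, map_pow, map_pow]
      refine mul_mem ?_ (pow_mem (Algebra.subset_adjoin (by simp [xFun])) n)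
      exact (Algebra.adjoin F {xFun W, yFun W}).algebraMap_mem c
  obtain ⟨p, q, rfl⟩ := CoordinateRing.exists_smul_basis_eq g
  rw [map_add, CoordinateRing.smul, CoordinateRing.smul, map_mul, map_mul, map_one, mul_one]
  exact add_mem (hp p) (mul_mem (hp q) (Algebra.subset_adjoin (by simp [yFun])))

instance : IsFractionRing (inftyRing W) W.FunctionField := by
  have hy := yFun_ne_zero W
  have hv : 1 / yFun W ∈ inftyRing W := Algebra.subset_adjoin (by simp)
  have hu : xFun W / yFun W ∈ inftyRing W := Algebra.subset_adjoin (by simp)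
  -- after multiplication by a power of `1/y` a polynomial in `x, y` lands in the chart at infinity
  have key : ∀ f ∈ Algebra.adjoin F {xFun W, yFun W},
      ∃ n : ℕ, ∀ m ≥ n, f * (1 / yFun W) ^ m ∈ inftyRing W := by
    intro f hf
    induction hf using Algebra.adjoin_induction with
    | mem f hf =>
      refine ⟨1, fun m hm => ?_⟩
      obtain ⟨m, rfl⟩ := Nat.exists_eq_add_of_le hm
      rw [pow_add, pow_one, ← mul_assoc]
      refine mul_mem ?_ (pow_mem hv m)
      rcases hf with rfl | rfl
      · rwa [mul_one_div]
      · rw [mul_one_div_cancel hy]; exact one_mem _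
    | algebraMap c =>
      exact ⟨0, fun m _ => mul_mem ((inftyRing W).algebraMap_mem c) (pow_mem hv m)⟩
    | add f g _ _ hf hg =>
      obtain ⟨n, hn⟩ := hf
      obtain ⟨k, hk⟩ := hg
      refine ⟨max n k, fun m hm => ?_⟩
      rw [add_mul]
      exact add_mem (hn m (le_trans (le_max_left _ _) hm)) (hk m (le_trans (le_max_right _ _) hm))
    | mul f g _ _ hf hg =>
      obtain ⟨n, hn⟩ := hf
      obtain ⟨k, hk⟩ := hg
      refine ⟨n + k, fun m hm => ?_⟩
      obtain ⟨j, rfl⟩ := Nat.exists_eq_add_of_le hm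
      have := mul_mem (mul_mem (hn n le_rfl) (hk k le_rfl)) (pow_mem hv j)
      convert this using 1
      rw [pow_add, pow_add]
      ring
  refine IsFractionRing.of_field (inftyRing W) W.FunctionField fun f => ?_
  obtain ⟨g, h, hh, rfl⟩ := IsFractionRing.div_surjective W.CoordinateRing f
  obtain ⟨n, hn⟩ := key _ (adjoin_xFun_yFun W g)
  obtain ⟨k, hk⟩ := key _ (adjoin_xFun_yFun W h)
  refine ⟨⟨_, hn (max n k) (le_max_left _ _)⟩, ⟨_, hk (max n k) (le_max_right _ _)⟩, ?_⟩
  have hvn : (1 / yFun W) ^ max n k ≠ 0 := pow_ne_zero _ (one_div_ne_zero hy)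
  exact (mul_div_mul_right _ _ hvn).symm

/-! ### Valuations at points -/

/-- The valuation `ν_P(f)` of a function `f` at a point `P` of the curve: the order of vanishing
of `f` along the ideal of `P`, in the affine chart `F[x, y]` if `P` is an affine point
and in the affine chart `F[x/y, 1/y]` if `P` is the point at infinity. -/
def pointOrder : W.Point → W.FunctionField → ℤ
  | .zero, f => fracOrder (inftyIdeal W) f
  | .some x y _, f => fracOrder (CoordinateRing.XYIdeal W x (C y)) f

/-! ### Maps from the coordinate ring given by points -/

variable {W} in
theorem eval₂_eq_zero_of_equation {L : Type*} [Field L] [Algebra F L] {x y : L}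
    (h : (W⁄L).Equation x y) : W.polynomial.eval₂ ((aeval x : F[X] →ₐ[F] L) : F[X] →+* L) y = 0 := by
  rw [equation_iff'] at h
  rw [← h]
  simp only [WeierstrassCurve.Affine.polynomial, eval₂_add, eval₂_sub, eval₂_mul, eval₂_pow, eval₂_X,
    eval₂_C, RingHom.coe_coe, map_add, map_mul, map_pow, aeval_C, aeval_X]
  change _ = y ^ 2 + algebraMap F L W.a₁ * x * y + algebraMap F L W.a₃ * y -
    (x ^ 3 + algebraMap F L W.a₂ * x ^ 2 + algebraMap F L W.a₄ * x + algebraMap F L W.a₆)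
  ring

variable {W} in
/-- The homomorphism from the coordinate ring to `L` given by evaluation at an `L`-point. -/
def evalHom {L : Type*} [Field L] [Algebra F L] {x y : L} (h : (W⁄L).Equation x y) :
    W.CoordinateRing →ₐ[F] L :=
  AdjoinRoot.liftAlgHom W.polynomial (aeval x : F[X] →ₐ[F] L) y (eval₂_eq_zero_of_equation h)

variable {W} in
theorem evalHom_C {L : Type*} [Field L] [Algebra F L] {x y : L} (h : (W⁄L).Equation x y)
    (p : F[X]) : evalHom h (CoordinateRing.mk W (C p)) = aeval x p :=
  AdjoinRoot.liftAlgHom_of _ _ _ _ _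

variable {W} in
theorem evalHom_X {L : Type*} [Field L] [Algebra F L] {x y : L} (h : (W⁄L).Equation x y) :
    evalHom h (CoordinateRing.mk W X) = y :=
  AdjoinRoot.liftAlgHom_root _ _ _ _

theorem equation_xFun_yFun : (W⁄W.FunctionField).Equation (xFun W) (yFun W) := by
  have h : CoordinateRing.mk W W.polynomial = 0 := AdjoinRoot.mk_self
  have h' := congrArg (algebraMap W.CoordinateRing W.FunctionField) h
  have hc : ∀ c : F, algebraMap W.CoordinateRing W.FunctionField (CoordinateRing.mk W (C (C c))) =
    algebraMap F W.FunctionField c := fun c => rfl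
  rw [equation_iff']
  simp only [WeierstrassCurve.Affine.polynomial, map_add, map_sub, map_mul, map_pow, hc,
    map_zero] at h'
  change yFun W ^ 2 + algebraMap F _ W.a₁ * xFun W * yFun W + algebraMap F _ W.a₃ * yFun W -
    (xFun W ^ 3 + algebraMap F _ W.a₂ * xFun W ^ 2 + algebraMap F _ W.a₄ * xFun W +
      algebraMap F _ W.a₆) = 0
  rw [← h', ← xFun, ← yFun]
  ring

/-- A nonzero element of the coordinate ring divides a nonzero polynomial in `x`. -/
theorem exists_C_mem_span {g : W.CoordinateRing} (hg : g ≠ 0) :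
    ∃ p : F[X], p ≠ 0 ∧ CoordinateRing.mk W (C p) ∈ Ideal.span {g} := by
  have : Module.Finite F[X] W.CoordinateRing := .of_basis (CoordinateRing.basis W)
  have hne := Ideal.comap_ne_bot_of_integral_mem (R := F[X]) hg (Ideal.mem_span_singleton_self g)
    (Algebra.IsIntegral.isIntegral g)
  obtain ⟨p, hp, hp0⟩ := Submodule.exists_mem_ne_zero_of_ne_bot hne
  exact ⟨p, hp0, hp⟩

/-! ### Divisors -/

theorem adicOrder_ne_zero {R : Type*} [CommRing R] {I : Ideal R} {g : R} (h : adicOrder I g ≠ 0) :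
    g ∈ I := by
  by_contra hg
  have hs : {n : ℕ | g ∈ I ^ n} = {0} := by
    ext n
    rcases Nat.eq_zero_or_pos n with rfl | hn
    · simp
    · simpa [hn.ne'] using fun h' => hg (Ideal.pow_le_self hn.ne' h')
  exact h (by rw [adicOrder, hs, csSup_singleton])

theorem finite_setOf_mem {g : W.CoordinateRing} (hg : g ≠ 0) :
    {P : F × F | W.Equation P.1 P.2 ∧ g ∈ CoordinateRing.XYIdeal W P.1 (C P.2)}.Finite := by
  obtain ⟨p, hp, hpg⟩ := exists_C_mem_span W hg
  have hroot : ∀ P ∈ {P : F × F | W.Equation P.1 P.2 ∧ g ∈ CoordinateRing.XYIdeal W P.1 (C P.2)},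
      p.IsRoot P.1 := by
    rintro ⟨x, y⟩ ⟨hP, hm⟩
    have hle : Ideal.span {g} ≤ CoordinateRing.XYIdeal W x (C y) := by
      rwa [Ideal.span_singleton_le_iff_mem]
    have hP' : (W⁄F).Equation x y := hP
    have hker : CoordinateRing.XYIdeal W x (C y) ≤ RingHom.ker (evalHom hP') := by
      rw [CoordinateRing.XYIdeal, Ideal.span_le]
      rintro _ (rfl | rfl)
      · simp only [SetLike.mem_coe, RingHom.mem_ker, CoordinateRing.XClass, evalHom_C]
        simp
      · simp only [SetLike.mem_coe, RingHom.mem_ker, CoordinateRing.YClass, map_sub, evalHom_C,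
          evalHom_X]
        simp
    have := hker (hle hpg)
    rw [RingHom.mem_ker, evalHom_C] at this
    simpa using this
  refine Set.Finite.subset (s := ⋃ x ∈ {x | p.IsRoot x},
    (fun y => (x, y)) '' {y | (W.polynomial.map (evalRingHom x)).IsRoot y}) ?_ ?_
  · refine Set.Finite.biUnion (Polynomial.finite_setOfPred_isRoot hp) fun x _ => ?_
    refine Set.Finite.image _ (Polynomial.finite_setOfPred_isRoot ?_)
    exact (WeierstrassCurve.Affine.monic_polynomial.map _).ne_zero
  · rintro ⟨x, y⟩ hP
    simp only [Set.mem_iUnion]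
    refine ⟨x, hroot _ hP, y, ?_, rfl⟩
    have hP' : (W⁄F).Equation x y := hP.1
    have h0 := eval₂_eq_zero_of_equation hP'
    rw [Set.mem_ofPred_eq, IsRoot.def, eval_map]
    exact h0

theorem finite_support_pointOrder (a : W.FunctionFieldˣ) :
    (Function.support fun P : W.Point => pointOrder W P a).Finite := by
  set g := (IsLocalization.sec (nonZeroDivisors W.CoordinateRing) (a : W.FunctionField)).1 with hg
  set h := (IsLocalization.sec (nonZeroDivisors W.CoordinateRing) (a : W.FunctionField)).2 with hh
  have hg0 : g ≠ 0 := by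
    intro h0
    have := IsLocalization.sec_spec (nonZeroDivisors W.CoordinateRing) (a : W.FunctionField)
    rw [← hg, ← hh, h0, map_zero] at this
    exact mul_ne_zero a.ne_zero (by simp) this
  have hh0 : (h : W.CoordinateRing) ≠ 0 := nonZeroDivisors.ne_zero h.2
  have hfin := ((((finite_setOf_mem W hg0).union (finite_setOf_mem W hh0)).image
    some).insert none)
  let c : W.Point → Option (F × F) := fun P => match P with
    | .zero => none
    | .some x y _ => some (x, y)
  have hc : Function.Injective c := by
    rintro (_ | ⟨x, y, _⟩) (_ | ⟨x', y', _⟩) hPQ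
    · rfl
    · cases hPQ
    · cases hPQ
    · cases hPQ; rfl
  refine Set.Finite.subset (hfin.preimage hc.injOn) ?_
  rintro (_ | ⟨x, y, hxy⟩) hP
  · exact Or.inl rfl
  · refine Or.inr ⟨(x, y), ?_, rfl⟩
    by_contra hnot
    refine hP ?_
    have h1 : adicOrder (CoordinateRing.XYIdeal W x (C y)) g = 0 := by
      by_contra h1
      exact hnot (Or.inl ⟨hxy.1, adicOrder_ne_zero h1⟩)
    have h2 : adicOrder (CoordinateRing.XYIdeal W x (C y)) (h : W.CoordinateRing) = 0 := by
      by_contra h2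
      exact hnot (Or.inr ⟨hxy.1, adicOrder_ne_zero h2⟩)
    change (adicOrder (CoordinateRing.XYIdeal W x (C y)) g : ℤ) -
      (adicOrder (CoordinateRing.XYIdeal W x (C y)) (h : W.CoordinateRing) : ℤ) = 0
    rw [h1, h2, sub_self]

/-- The divisor `div(a) = ∑ ν_P(a) [P]` of a nonzero function `a`. -/
def divisor (a : W.FunctionFieldˣ) : W.Point →₀ ℤ :=
  Finsupp.ofSupportFinite (fun P => pointOrder W P a) (finite_support_pointOrder W a)

end Curve

section Translation

variable {F : Type*} [Field F] (W : WeierstrassCurve.Affine F)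

open scoped Classical in
/-- The embedding of the group of points of the curve over `F` into its group of points over
the function field. -/
def constPoint [DecidableEq F] : W.Point →+ (W⁄W.FunctionField).Point :=
  Point.map (W' := W) (F := F) (Algebra.ofId F W.FunctionField)

/-- The generic point `(x, y)` of the curve, a point over the function field. -/
def genericPoint [W.IsElliptic] : (W⁄W.FunctionField).Point :=
  have : (W⁄W.FunctionField).IsElliptic := inferInstanceAs (W.map _).IsElliptic
  .some (xFun W) (yFun W) ((W⁄W.FunctionField).equation_iff_nonsingular.1 (equation_xFun_yFun W))

open scoped Classical in
theorem algHom_ext_of_map_genericPoint [W.IsElliptic]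
    {τ σ : W.FunctionField →ₐ[F] W.FunctionField}
    (h : Point.map (W' := W) τ (genericPoint W) = Point.map (W' := W) σ (genericPoint W)) : τ = σ := by
  have h' := h
  rw [genericPoint, Point.map_some, Point.map_some] at h'
  injection h' with hx hy
  have hle : Algebra.adjoin F {xFun W, yFun W} ≤ AlgHom.equalizer τ σ :=
    Algebra.adjoin_le (by rintro _ (rfl | rfl); exacts [hx, hy])
  have hring : (τ : W.FunctionField →+* W.FunctionField) = σ :=
    IsFractionRing.ringHom_ext (A := W.CoordinateRing) fun g => hle (adjoin_xFun_yFun W g)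
  exact AlgHom.ext fun f => RingHom.congr_fun hring f

theorem xFun_ne_algebraMap (x₀ : F) : xFun W ≠ algebraMap F W.FunctionField x₀ := by
  intro h
  have h' : algebraMap W.CoordinateRing W.FunctionField (CoordinateRing.XClass W x₀) = 0 := by
    rw [CoordinateRing.XClass, C_sub, map_sub, map_sub]
    exact sub_eq_zero.2 h
  rw [map_eq_zero_iff _ (IsFractionRing.injective W.CoordinateRing W.FunctionField)] at h'
  exact CoordinateRing.XClass_ne_zero x₀ h'

theorem genericPoint_ne_constPoint [DecidableEq F] [W.IsElliptic] (P : W.Point) : genericPoint W ≠ constPoint W P := by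
  intro h
  rcases P with _ | ⟨x₀, y₀, h₀⟩
  · exact Point.some_ne_zero _ h
  · injection h with hx _
    exact xFun_ne_algebraMap W x₀ hx

theorem exists_algebraMap_eq_of_aeval_eq_zero {L : Type*} [Field L] [Algebra F L] [IsAlgClosed F]
    {p : F[X]} (hp : p ≠ 0) {z : L} (hz : aeval z p = 0) : ∃ c : F, algebraMap F L c = z := by
  have hint : IsIntegral F z := isAlgebraic_iff_isIntegral.1 ⟨p, hp, hz⟩
  have hdeg := IsAlgClosed.degree_eq_one_of_irreducible F (minpoly.irreducible hint)
  exact minpoly.mem_range_of_degree_eq_one F z hdeg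

theorem evalHom_injective [DecidableEq F] [IsAlgClosed F]
    {x y : W.FunctionField}
    (h : (W⁄W.FunctionField).Nonsingular x y)
    (hconst : ∀ P : W.Point, Point.some x y h ≠ constPoint W P) :
    Function.Injective (evalHom h.1) := by
  rw [injective_iff_map_eq_zero]
  intro g hg
  by_contra hg0
  obtain ⟨p, hp0, hpg⟩ := exists_C_mem_span W hg0
  have hpx : aeval x p = 0 := by
    rw [← evalHom_C h.1]
    exact (Ideal.span_singleton_le_iff_mem (I := RingHom.ker (evalHom h.1))).2 hg hpg
  obtain ⟨x₀, rfl⟩ := exists_algebraMap_eq_of_aeval_eq_zero hp0 hpx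
  have hy := eval₂_eq_zero_of_equation h.1
  have hx₀ : ((aeval (algebraMap F W.FunctionField x₀) : F[X] →ₐ[F] W.FunctionField) :
      F[X] →+* W.FunctionField) = (algebraMap F W.FunctionField).comp (evalRingHom x₀) := by
    ext q
    · simp
    · simp
  rw [hx₀, ← eval₂_map, ← aeval_def] at hy
  obtain ⟨y₀, rfl⟩ := exists_algebraMap_eq_of_aeval_eq_zero
    (WeierstrassCurve.Affine.monic_polynomial.map (evalRingHom x₀)).ne_zero hy
  exact hconst (.some x₀ y₀ ((W.map_nonsingular
    (algebraMap F W.FunctionField).injective x₀ y₀).1 h)) rfl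

open scoped Classical in
theorem exists_algHom_map_genericPoint [DecidableEq F] [W.IsElliptic] [IsAlgClosed F]
    (s : W.Point) :
    ∃ τ : W.FunctionField →ₐ[F] W.FunctionField,
      Point.map (W' := W) τ (genericPoint W) = genericPoint W + constPoint W s := by
  have hne : ∀ P : W.Point, genericPoint W + constPoint W s ≠ constPoint W P := by
    intro P hP
    refine genericPoint_ne_constPoint W (P - s) ?_
    rw [map_sub, ← hP, add_sub_cancel_right]
  rcases hQ : genericPoint W + constPoint W s with _ | ⟨x, y, h⟩
  · exact absurd hQ (hne 0)
  · rw [hQ] at hne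
    refine ⟨IsFractionRing.liftAlgHom (evalHom_injective W h hne), ?_⟩
    rw [genericPoint, Point.map_some]
    simp only [Point.some.injEq, IsFractionRing.liftAlgHom_apply, xFun, yFun]
    exact ⟨(IsFractionRing.lift_algebraMap _ _).trans ((evalHom_C _ _).trans (aeval_X _)),
      (IsFractionRing.lift_algebraMap _ _).trans (evalHom_X _)⟩

open scoped Classical in
theorem exists_algEquiv_map_genericPoint [DecidableEq F] [W.IsElliptic] [IsAlgClosed F]
    (s : W.Point) :
    ∃ τ : W.FunctionField ≃ₐ[F] W.FunctionField,
      Point.map (W' := W) (τ : W.FunctionField →ₐ[F] W.FunctionField) (genericPoint W) =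
        genericPoint W + constPoint W s := by
  have hconst : ∀ (τ : W.FunctionField →ₐ[F] W.FunctionField) (P : W.Point),
      Point.map (W' := W) τ (constPoint W P) = constPoint W P :=
    fun τ P => Point.map_baseChange (W' := W) τ P
  have hcomp : ∀ (t : W.Point) (τ σ : W.FunctionField →ₐ[F] W.FunctionField),
      Point.map (W' := W) τ (genericPoint W) = genericPoint W + constPoint W t →
      Point.map (W' := W) σ (genericPoint W) = genericPoint W + constPoint W (-t) →
      τ.comp σ = AlgHom.id F _ := by
    intro t τ σ hτ hσ
    refine algHom_ext_of_map_genericPoint W ?_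
    rw [← Point.map_map, hσ, map_add, hτ, hconst, map_neg, add_neg_cancel_right]
    rfl
  obtain ⟨τ, hτ⟩ := exists_algHom_map_genericPoint W s
  obtain ⟨σ, hσ⟩ := exists_algHom_map_genericPoint W (-s)
  refine ⟨AlgEquiv.ofAlgHom τ σ (hcomp s τ σ hτ hσ) (hcomp (-s) σ τ hσ ?_), ?_⟩
  · rw [neg_neg, hτ]
  · exact hτ

/-- The automorphism `τ` of the function field induced by the translation `P ↦ P + s`, that is,
`(τ f)(P) = f(P + s)`. It is the only one for which `(τ x, τ y)` is the sum of the
generic point `(x, y)` and the point `s`. -/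
def translation [DecidableEq F] [IsAlgClosed F] [W.IsElliptic] (s : W.Point) :
    W.FunctionField ≃ₐ[F] W.FunctionField :=
  (exists_algEquiv_map_genericPoint W s).choose

open scoped Classical in
theorem map_translation_genericPoint [DecidableEq F] [IsAlgClosed F] [W.IsElliptic] (s : W.Point) :
    Point.map (W' := W) (translation W s : W.FunctionField →ₐ[F] W.FunctionField)
      (genericPoint W) = genericPoint W + constPoint W s :=
  (exists_algEquiv_map_genericPoint W s).choose_spec

end Translation

end EllipticFunctions

end

/-! Translation shifts divisors: the divisor of `τ r` at `P` is the divisor of `r` at `P + s`. Since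
functions with zero divisor are constant, `a = c · τ(r)/r` is solvable exactly when `div a = shift s
E - E` for some principal `E`. By Abel's theorem, principal means of degree `0` and of sum `0` in
the group. It remains to recognise these conditions on `E` from `D = shift s E - E` alone. In the
coordinates `P = α ω + n • s`, such an `E` exists if and only if all orbit sums of `D` vanish.
Shifting lowers `n` by one, so weighting by `n` gives minus the degree of `E`, and weighting by `n •
α ω + n(n+1)/2 • s` gives minus its sum (`orbitMoment_shift_sub`, `orbitSum_shift_sub`).

Abel's theorem: lines give functions with divisor `[P] + [Q] - [P + Q] - [0]`, so every divisor is
equivalent to some `[S] + m[0]`. If the latter is principal with `S` affine, the ideal of `S` is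
principal, against the injectivity of the map from points to the ideal class group
(`eq_zero_of_divisor_eq_single_add`).

The automorphism `τ` is known only through its value at the generic point, so its effect on orders
has to be derived. Every normalized order function is the order at a point (`exists_eq_pointOrder`),
hence `τ` induces a permutation `π` of the points. The addition formula gives `π P = P + s` away
from `0, s, -s`. Preservation of principal divisors makes `π` affine, and the infinitely many
multiples of `s` provide enough good points to conclude everywhere (`pointOrder_translation`). -/

namespace EllipticFunctions

/-! ### Order functions -/

/-- A function to the integers that is additive on products of nonzero elements and satisfies the
ultrametric inequality. The value at `0` is irrelevant. -/
structure IsOrder {R : Type*} [CommRing R] (v : R → ℤ) : Prop where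
  mul : ∀ {f g : R}, f ≠ 0 → g ≠ 0 → v (f * g) = v f + v g
  add : ∀ {f g : R} {n : ℤ}, f ≠ 0 → g ≠ 0 → f + g ≠ 0 → n ≤ v f → n ≤ v g → n ≤ v (f + g)

/-- `v f ≥ n`, with the convention that the order of `0` is infinite. -/
def OrderGE {R : Type*} [CommRing R] (v : R → ℤ) (n : ℤ) (f : R) : Prop :=
  f ≠ 0 → n ≤ v f

namespace IsOrder

section Ring

variable {R : Type*} [CommRing R] [IsDomain R] {v : R → ℤ} (hv : IsOrder v)
include hv

theorem one : v 1 = 0 := by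
  have := hv.mul (one_ne_zero (α := R)) one_ne_zero
  rw [mul_one] at this
  lia

theorem pow {f : R} (hf : f ≠ 0) (n : ℕ) : v (f ^ n) = n * v f := by
  induction n with
  | zero => simp [hv.one]
  | succ n ih =>
    rw [pow_succ, hv.mul (pow_ne_zero n hf) hf, ih]
    push_cast
    ring

theorem neg_one : v (-1) = 0 := by
  have := hv.mul (neg_ne_zero.2 (one_ne_zero (α := R))) (neg_ne_zero.2 one_ne_zero)
  rw [neg_one_mul, neg_neg, hv.one] at this
  lia

theorem neg (f : R) : v (-f) = v f := by
  by_cases hf : f = 0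
  · rw [hf, neg_zero]
  · rw [← neg_one_mul, hv.mul (neg_ne_zero.2 one_ne_zero) hf, hv.neg_one, zero_add]

omit [IsDomain R] in
theorem orderGE_add {n : ℤ} {f g : R} (hf : OrderGE v n f) (hg : OrderGE v n g) :
    OrderGE v n (f + g) := by
  intro h
  by_cases hf0 : f = 0
  · subst hf0
    rw [zero_add] at h ⊢
    exact hg h
  by_cases hg0 : g = 0
  · subst hg0
    rw [add_zero] at h ⊢
    exact hf h
  exact hv.add hf0 hg0 h (hf hf0) (hg hg0)

theorem orderGE_neg {n : ℤ} {f : R} (hf : OrderGE v n f) : OrderGE v n (-f) := by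
  intro h
  rw [hv.neg]
  exact hf (neg_ne_zero.1 h)

theorem orderGE_sub {n : ℤ} {f g : R} (hf : OrderGE v n f) (hg : OrderGE v n g) :
    OrderGE v n (f - g) := by
  rw [sub_eq_add_neg]
  exact hv.orderGE_add hf (hv.orderGE_neg hg)

omit [IsDomain R] in
theorem orderGE_mul {m n : ℤ} {f g : R} (hf : OrderGE v m f) (hg : OrderGE v n g) :
    OrderGE v (m + n) (f * g) := by
  intro h
  rw [hv.mul (left_ne_zero_of_mul h) (right_ne_zero_of_mul h)]
  exact add_le_add (hf (left_ne_zero_of_mul h)) (hg (right_ne_zero_of_mul h))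

/-- The order of a sum of elements of different order. -/
theorem add_eq_left {f g : R} (hf : f ≠ 0) (hg : OrderGE v (v f + 1) g) :
    f + g ≠ 0 ∧ v (f + g) = v f := by
  by_cases hg0 : g = 0
  · simpa [hg0] using hf
  have h1 := hg hg0
  have hne : f + g ≠ 0 := by
    intro h
    rw [eq_neg_of_add_eq_zero_right h, hv.neg] at h1
    lia
  refine ⟨hne, le_antisymm ?_ (hv.add hf hg0 hne le_rfl (by lia))⟩
  by_contra! hlt
  have h2 : OrderGE v (v f + 1) (f + g - g) := hv.orderGE_sub (fun _ => hlt) hg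
  rw [add_sub_cancel_right] at h2
  have := h2 hf
  lia

end Ring

section Field

variable {K : Type*} [Field K] {v : K → ℤ} (hv : IsOrder v)
include hv

theorem inv {f : K} (hf : f ≠ 0) : v f⁻¹ = -v f := by
  have := hv.mul hf (inv_ne_zero hf)
  rw [mul_inv_cancel₀ hf, hv.one] at this
  lia

theorem div {f g : K} (hf : f ≠ 0) (hg : g ≠ 0) : v (f / g) = v f - v g := by
  rw [div_eq_mul_inv, hv.mul hf (inv_ne_zero hg), hv.inv hg, sub_eq_add_neg]

theorem comp_ringEquiv (τ : K ≃+* K) : IsOrder fun f => v (τ f) where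
  mul hf hg := by
    simp only [map_mul]
    exact hv.mul (by simpa) (by simpa)
  add hf hg h hn hm := by
    simp only [map_add]
    refine hv.add (by simpa) (by simpa) ?_ hn hm
    rwa [← map_add, map_ne_zero_iff _ τ.injective]

/-- An order function on a field is trivial on algebraically closed subfields. -/
theorem algebraMap_eq_zero {F : Type*} [Field F] [IsAlgClosed F] [Algebra F K] {c : F}
    (hc : c ≠ 0) : v (algebraMap F K c) = 0 := by
  -- Extract a root of degree `|v c| + 1`: then `v c` is divisible by an integer larger than its
  -- absolute value.
  obtain ⟨z, hz⟩ := IsAlgClosed.exists_pow_nat_eq c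
    (n := (v (algebraMap F K c)).natAbs + 1) (Nat.succ_pos _)
  have hz0 : z ≠ 0 := by
    rintro rfl
    exact hc (by rw [← hz, zero_pow (Nat.succ_ne_zero _)])
  have h := hv.pow ((map_ne_zero (algebraMap F K)).2 hz0) ((v (algebraMap F K c)).natAbs + 1)
  rw [← map_pow, hz] at h
  refine Int.eq_zero_of_abs_lt_dvd (Dvd.intro _ h.symm) ?_
  push_cast
  lia

theorem orderGE_algebraMap {F : Type*} [Field F] [IsAlgClosed F] [Algebra F K] (c : F) :
    OrderGE v 0 (algebraMap F K c) := fun h =>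
  (hv.algebraMap_eq_zero (by rintro rfl; simp at h)).ge

/-- The elements of nonnegative order. -/
def subring : Subring K where
  carrier := {f | OrderGE v 0 f}
  mul_mem' hf hg := by simpa using hv.orderGE_mul hf hg
  one_mem' := fun _ => hv.one.ge
  add_mem' hf hg := hv.orderGE_add hf hg
  zero_mem' := fun h => absurd rfl h
  neg_mem' hf := hv.orderGE_neg hf

end Field

end IsOrder

/-! ### Extension of order functions to the fraction field -/

section Extend

variable {R K : Type*} [CommRing R] [IsDomain R] [Field K] [Algebra R K] [IsFractionRing R K]

/-- The extension of an order function to the fraction field. -/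
noncomputable def extendOrder (d : R → ℤ) (f : K) : ℤ :=
  d (IsLocalization.sec (nonZeroDivisors R) f).1 -
    d ((IsLocalization.sec (nonZeroDivisors R) f).2 : R)

/-- Cross-multiplication shows that the value does not depend on the fraction, in particular not on
the one chosen by `IsLocalization.sec`. -/
theorem extendOrder_div {d : R → ℤ} (hd : IsOrder d) {g h : R} (hg : g ≠ 0) (hh : h ≠ 0) :
    extendOrder d (algebraMap R K g / algebraMap R K h) = d g - d h := by
  set f : K := algebraMap R K g / algebraMap R K h with hf
  have hinj := IsFractionRing.injective R K
  have h1 : algebraMap R K h ≠ 0 := by rwa [map_ne_zero_iff _ hinj]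
  have hf0 : f ≠ 0 := div_ne_zero (by rwa [map_ne_zero_iff _ hinj]) h1
  have h2 := IsLocalization.sec_spec (nonZeroDivisors R) f
  rw [extendOrder]
  set p := (IsLocalization.sec (nonZeroDivisors R) f).1
  set q := (IsLocalization.sec (nonZeroDivisors R) f).2
  have hq : (q : R) ≠ 0 := nonZeroDivisors.ne_zero q.2
  have hp : p ≠ 0 := by
    intro hp
    rw [hp, map_zero] at h2
    exact mul_ne_zero hf0 (by rwa [map_ne_zero_iff _ hinj]) h2
  have h3 : g * q = p * h := by
    apply hinj
    rw [map_mul, map_mul, ← h2, hf]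
    field_simp
  have h4 := congrArg d h3
  rw [hd.mul hg hq, hd.mul hp hh] at h4
  lia

theorem extendOrder_algebraMap {d : R → ℤ} (hd : IsOrder d) {g : R} (hg : g ≠ 0) :
    extendOrder d (algebraMap R K g) = d g := by
  simpa [hd.one] using extendOrder_div (K := K) hd hg one_ne_zero

theorem isOrder_extendOrder {d : R → ℤ} (hd : IsOrder d) :
    IsOrder (extendOrder d : K → ℤ) where
  mul {f f'} hf hf' := by
    obtain ⟨g, h, hh, rfl⟩ := IsFractionRing.div_surjective R f
    obtain ⟨g', h', hh', rfl⟩ := IsFractionRing.div_surjective R f'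
    have hg : g ≠ 0 := by rintro rfl; simp at hf
    have hg' : g' ≠ 0 := by rintro rfl; simp at hf'
    have hh := nonZeroDivisors.ne_zero hh
    have hh' := nonZeroDivisors.ne_zero hh'
    rw [div_mul_div_comm, ← map_mul, ← map_mul, extendOrder_div hd hg hh, extendOrder_div hd hg' hh',
      extendOrder_div hd (mul_ne_zero hg hg') (mul_ne_zero hh hh'), hd.mul hg hg', hd.mul hh hh']
    ring
  add {f f' n} hf hf' hff' hn hn' := by
    obtain ⟨g, h, hh, rfl⟩ := IsFractionRing.div_surjective R f
    obtain ⟨g', h', hh', rfl⟩ := IsFractionRing.div_surjective R f'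
    have hg : g ≠ 0 := by rintro rfl; simp at hf
    have hg' : g' ≠ 0 := by rintro rfl; simp at hf'
    have hh := nonZeroDivisors.ne_zero hh
    have hh' := nonZeroDivisors.ne_zero hh'
    have hinj := IsFractionRing.injective R K
    have key : algebraMap R K g / algebraMap R K h + algebraMap R K g' / algebraMap R K h' =
        algebraMap R K (g * h' + h * g') / algebraMap R K (h * h') := by
      rw [div_add_div _ _ (by rwa [map_ne_zero_iff _ hinj]) (by rwa [map_ne_zero_iff _ hinj])]
      simp
    rw [key] at hff' ⊢
    rw [extendOrder_div hd hg hh] at hn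
    rw [extendOrder_div hd hg' hh'] at hn'
    have hs : g * h' + h * g' ≠ 0 := by intro h0; rw [h0] at hff'; simp at hff'
    rw [extendOrder_div hd hs (mul_ne_zero hh hh'), hd.mul hh hh']
    have := hd.add (n := n + d h + d h') (mul_ne_zero hg hh') (mul_ne_zero hh hg') hs
      (by rw [hd.mul hg hh']; lia) (by rw [hd.mul hh hg']; lia)
    lia

end Extend

/-! ### The order along a locally principal maximal ideal -/

/-- The ideal `I` is maximal, and `t` generates it locally. -/
structure IsUniformizer {R : Type*} [CommRing R] (I : Ideal R) (t : R) : Prop where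
  isMaximal : I.IsMaximal
  ne_zero : t ≠ 0
  mem : t ∈ I
  exists_mul_eq : ∀ g ∈ I, ∃ u ∉ I, ∃ h, u * g = t * h

namespace IsUniformizer

section

variable {R : Type*} [CommRing R] {I : Ideal R} {t : R} (ht : IsUniformizer I t)
include ht

theorem mul_notMem {u w : R} (hu : u ∉ I) (hw : w ∉ I) : u * w ∉ I :=
  fun h => (ht.isMaximal.isPrime.mem_or_mem h).elim hu hw

/-- Local principality passes to powers of `I`: the multipliers outside `I` accumulate, and stay
outside because `I` is prime. This replaces passing to the localization. -/
theorem exists_mul_eq_pow {n : ℕ} {g : R} (hg : g ∈ I ^ n) : ∃ u ∉ I, ∃ h, u * g = t ^ n * h := by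
  induction n generalizing g with
  | zero => exact ⟨1, fun h => ht.isMaximal.ne_top ((Ideal.eq_top_iff_one _).2 h), g, by simp⟩
  | succ n ih =>
    rw [pow_succ] at hg
    induction hg using Submodule.mul_induction_on' with
    | mem_mul_mem a ha b hb =>
      obtain ⟨u, hu, h, e⟩ := ih ha
      obtain ⟨u', hu', h', e'⟩ := ht.exists_mul_eq b hb
      exact ⟨u * u', ht.mul_notMem hu hu', h * h', by linear_combination u' * b * e + t ^ n * h * e'⟩
    | add a _ b _ iha ihb =>
      obtain ⟨u, hu, h, e⟩ := iha
      obtain ⟨u', hu', h', e'⟩ := ihb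
      exact ⟨u * u', ht.mul_notMem hu hu', u' * h + u * h', by linear_combination u' * e + u * e'⟩

/-- An element outside the maximal ideal `I` is invertible modulo `I`, hence modulo every power of
`I`. -/
theorem mem_pow_of_mul_mem {n : ℕ} {u g : R} (hu : u ∉ I) (h : u * g ∈ I ^ n) : g ∈ I ^ n := by
  have := ht.isMaximal
  have hc : IsCoprime (I ^ n) (Ideal.span {u}) := by
    refine IsCoprime.pow_left ?_
    obtain ⟨y, i, hi, e⟩ := this.exists_inv hu
    exact Ideal.isCoprime_iff_exists.2
      ⟨i, hi, y * u, Ideal.mul_mem_left _ _ (Ideal.mem_span_singleton_self u), by rw [add_comm, e]⟩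
  obtain ⟨a, ha, b, hb, hab⟩ := Ideal.isCoprime_iff_exists.1 hc
  obtain ⟨c, rfl⟩ := Ideal.mem_span_singleton'.1 hb
  have : g = a * g + c * (u * g) := by linear_combination -g * hab
  rw [this]
  exact add_mem (Ideal.mul_mem_right _ _ ha) (Ideal.mul_mem_left _ _ h)

end

variable {R : Type*} [CommRing R] [IsDomain R] {I : Ideal R} {t : R} (ht : IsUniformizer I t)
include ht

/-- If `g` were in `I ^ (n + 1)`, cancelling `t ^ n` would put a product of two elements outside `I`
into `I`. -/
theorem mem_pow_iff {u w g : R} {n : ℕ} (hu : u ∉ I) (hw : w ∉ I) (h : u * g = w * t ^ n) (m : ℕ) :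
    g ∈ I ^ m ↔ m ≤ n := by
  constructor
  · intro hg
    by_contra! hlt
    obtain ⟨u', hu', h', e⟩ := ht.exists_mul_eq_pow (Ideal.pow_le_pow_right hlt hg)
    refine ht.mul_notMem hu' hw ?_
    have : u' * w = t * (u * h') := by
      refine mul_right_cancel₀ (pow_ne_zero n ht.ne_zero) ?_
      rw [pow_succ] at e
      linear_combination -u' * h + u * e
    rw [this]
    exact Ideal.mul_mem_right _ _ ht.mem
  · intro hmn
    refine ht.mem_pow_of_mul_mem hu ?_
    rw [h]
    exact Ideal.pow_le_pow_right hmn (Ideal.mul_mem_left _ _ (Ideal.pow_mem_pow ht.mem n))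

theorem adicOrder_eq {u w g : R} {n : ℕ} (hu : u ∉ I) (hw : w ∉ I) (h : u * g = w * t ^ n) :
    adicOrder I g = n := by
  have : {m : ℕ | g ∈ I ^ m} = Set.Iic n := Set.ext fun m => ht.mem_pow_iff hu hw h m
  rw [adicOrder, this, csSup_Iic]

omit [IsDomain R] in
theorem one_notMem : (1 : R) ∉ I := fun h => ht.isMaximal.ne_top ((Ideal.eq_top_iff_one _).2 h)

theorem adicOrder_self : adicOrder I t = 1 :=
  ht.adicOrder_eq ht.one_notMem ht.one_notMem (by simp)

variable [IsNoetherianRing R]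

/-- Krull's intersection theorem provides a last power of `I` containing `g`, so the supremum in
`adicOrder` is attained and is not the default value. The cofactor of `t ^ n` avoids `I`, for
otherwise `g` would lie in the next power. -/
theorem exists_eq_mul_pow {g : R} (hg : g ≠ 0) :
    ∃ u ∉ I, ∃ w ∉ I, u * g = w * t ^ adicOrder I g := by
  classical
  have hex : ∃ n, g ∉ I ^ n := by
    by_contra! hall
    have : g ∈ (⨅ n : ℕ, I ^ n) := by simpa [Ideal.mem_iInf] using hall
    rw [Ideal.iInf_pow_eq_bot_of_isDomain I ht.isMaximal.ne_top] at this
    exact hg this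
  obtain ⟨n, hn, hlt⟩ : ∃ n, g ∈ I ^ n ∧ g ∉ I ^ (n + 1) := by
    obtain ⟨n, hn⟩ : ∃ n, Nat.find hex = n + 1 :=
      Nat.exists_eq_succ_of_ne_zero fun h0 => Nat.find_spec hex (by rw [h0]; simp)
    exact ⟨n, not_not.1 (Nat.find_min hex (by lia)), hn ▸ Nat.find_spec hex⟩
  obtain ⟨u, hu, h, e⟩ := ht.exists_mul_eq_pow hn
  have hh : h ∉ I := by
    intro hh
    refine hlt (ht.mem_pow_of_mul_mem hu ?_)
    rw [e, pow_succ]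
    exact Ideal.mul_mem_mul (Ideal.pow_mem_pow ht.mem n) hh
  have e' : u * g = h * t ^ n := by rw [e, mul_comm]
  exact ⟨u, hu, h, hh, by rwa [ht.adicOrder_eq hu hh e']⟩

theorem le_adicOrder_iff {g : R} (hg : g ≠ 0) (m : ℕ) : m ≤ adicOrder I g ↔ g ∈ I ^ m := by
  obtain ⟨u, hu, w, hw, e⟩ := ht.exists_eq_mul_pow hg
  exact (ht.mem_pow_iff hu hw e m).symm

theorem isOrder_adicOrder : IsOrder fun g => (adicOrder I g : ℤ) where
  mul {f g} hf hg := by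
    obtain ⟨u, hu, w, hw, e⟩ := ht.exists_eq_mul_pow hf
    obtain ⟨u', hu', w', hw', e'⟩ := ht.exists_eq_mul_pow hg
    rw [ht.adicOrder_eq (n := adicOrder I f + adicOrder I g) (ht.mul_notMem hu hu')
      (ht.mul_notMem hw hw')]
    · push_cast; rfl
    · rw [pow_add]
      linear_combination u' * g * e + w * t ^ adicOrder I f * e'
  add {f g n} hf hg h hn hm := by
    rcases le_or_gt n 0 with h0 | h0
    · lia
    lift n to ℕ using h0.le
    rw [Nat.cast_le, ht.le_adicOrder_iff hf] at hn
    rw [Nat.cast_le, ht.le_adicOrder_iff hg] at hm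
    rw [Nat.cast_le, ht.le_adicOrder_iff h]
    exact add_mem hn hm

variable {K : Type*} [Field K] [Algebra R K] [IsFractionRing R K]

/-- By definition `fracOrder I` is `extendOrder` of the integer-valued `adicOrder I`. -/
theorem isOrder_fracOrder : IsOrder (fracOrder I : K → ℤ) :=
  isOrder_extendOrder ht.isOrder_adicOrder

theorem fracOrder_algebraMap {g : R} (hg : g ≠ 0) :
    fracOrder I (algebraMap R K g) = adicOrder I g :=
  extendOrder_algebraMap ht.isOrder_adicOrder hg

theorem one_le_fracOrder_iff {g : R} (hg : g ≠ 0) :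
    1 ≤ fracOrder I (algebraMap R K g) ↔ g ∈ I := by
  rw [ht.fracOrder_algebraMap hg, ← Nat.cast_one, Nat.cast_le, ht.le_adicOrder_iff hg, pow_one]

theorem fracOrder_self : fracOrder I (algebraMap R K t) = 1 := by
  rw [ht.fracOrder_algebraMap ht.ne_zero, ht.adicOrder_self, Nat.cast_one]

/-- An order function centered at the ideal `I` is a multiple of the order along `I`. -/
theorem eq_mul_fracOrder {v : K → ℤ} (hv : IsOrder v)
    (h0 : ∀ g : R, OrderGE v 0 (algebraMap R K g))
    (h1 : ∀ g ∈ I, OrderGE v 1 (algebraMap R K g)) {f : K} (hf : f ≠ 0) :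
    v f = v (algebraMap R K t) * fracOrder I f := by
  have hinj := IsFractionRing.injective R K
  -- Modulo `I` there is an inverse `a` of `u`, so `a * u = 1 - i` with `i ∈ I` has order `0`; two
  -- nonnegative orders with sum `0` vanish.
  have hu0 : ∀ u ∉ I, v (algebraMap R K u) = 0 := by
    intro u hu
    obtain ⟨a, i, hi, hai⟩ := ht.isMaximal.exists_inv hu
    have hune : u ≠ 0 := by rintro rfl; exact hu I.zero_mem
    have hane : a ≠ 0 := by
      rintro rfl
      rw [zero_mul, zero_add] at hai
      exact ht.one_notMem (hai ▸ hi)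
    have hu' := h0 u (by rwa [map_ne_zero_iff _ hinj])
    have ha' := h0 a (by rwa [map_ne_zero_iff _ hinj])
    have e : algebraMap R K a * algebraMap R K u = 1 + -algebraMap R K i := by
      rw [← map_mul, eq_sub_of_add_eq hai, map_sub, map_one, sub_eq_add_neg]
    have h2 := (hv.add_eq_left (one_ne_zero (α := K)) (g := -algebraMap R K i)
      (by rw [hv.one, zero_add]; exact hv.orderGE_neg (h1 i hi))).2
    rw [← e, hv.mul (by rwa [map_ne_zero_iff _ hinj]) (by rwa [map_ne_zero_iff _ hinj]),
      hv.one] at h2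
    lia
  have hR : ∀ g : R, g ≠ 0 → v (algebraMap R K g) = v (algebraMap R K t) * adicOrder I g := by
    intro g hg
    obtain ⟨u, hu, w, hw, e⟩ := ht.exists_eq_mul_pow hg
    have hune : u ≠ 0 := by rintro rfl; exact hu I.zero_mem
    have hwne : w ≠ 0 := by rintro rfl; exact hw I.zero_mem
    have e' := congrArg (fun z => v (algebraMap R K z)) e
    have htK : algebraMap R K t ≠ 0 := by rw [map_ne_zero_iff _ hinj]; exact ht.ne_zero
    simp only [map_mul, map_pow] at e'
    rw [hv.mul (by rwa [map_ne_zero_iff _ hinj]) (by rwa [map_ne_zero_iff _ hinj]),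
      hv.mul (by rwa [map_ne_zero_iff _ hinj]) (pow_ne_zero _ htK), hu0 u hu, hu0 w hw,
      hv.pow htK] at e'
    linarith
  obtain ⟨g, h, hh, rfl⟩ := IsFractionRing.div_surjective R f
  have hg : g ≠ 0 := by rintro rfl; simp at hf
  have hh := nonZeroDivisors.ne_zero hh
  have hgK : algebraMap R K g ≠ 0 := by rwa [map_ne_zero_iff _ hinj]
  have hhK : algebraMap R K h ≠ 0 := by rwa [map_ne_zero_iff _ hinj]
  rw [hv.div hgK hhK, hR g hg, hR h hh, ht.isOrder_fracOrder.div hgK hhK,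
    ht.fracOrder_algebraMap hg, ht.fracOrder_algebraMap hh]
  ring

/-- A normalized order function centered at the ideal `I` is the order along `I`. -/
theorem eq_fracOrder {v : K → ℤ} (hv : IsOrder v)
    (h0 : ∀ g : R, OrderGE v 0 (algebraMap R K g))
    (h1 : ∀ g ∈ I, OrderGE v 1 (algebraMap R K g)) (hsurj : ∃ f ≠ 0, v f = 1)
    {f : K} (hf : f ≠ 0) : v f = fracOrder I f := by
  obtain ⟨f₁, hf₁, e⟩ := hsurj
  rw [ht.eq_mul_fracOrder hv h0 h1 hf₁] at e
  have htK : algebraMap R K t ≠ 0 := by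
    rw [map_ne_zero_iff _ (IsFractionRing.injective R K)]; exact ht.ne_zero
  have h2 := h1 t ht.mem htK
  rcases Int.eq_one_or_neg_one_of_mul_eq_one e with h3 | h3
  · rw [ht.eq_mul_fracOrder hv h0 h1 hf, h3, one_mul]
  · lia

end IsUniformizer

/-- A maximal ideal that divides a nonzero principal ideal is locally principal. -/
theorem exists_isUniformizer {R : Type*} [CommRing R] [IsDomain R] {I J : Ideal R} {d : R}
    (hI : I.IsMaximal) (hd : d ≠ 0) (hIJ : J * I = Ideal.span {d}) : ∃ t, IsUniformizer I t := by
  -- If all products `j * t` were in `d I`, then `(d) = J I ⊆ d I`, which forces `1 ∈ I`. For a good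
  -- pair write `j * t = d * u` with `u ∉ I` and `j * g = d * h`; then `u * g = t * h`.
  have hex : ∃ j ∈ J, ∃ t ∈ I, j * t ∉ Ideal.span {d} * I := by
    by_contra! hall
    have hle : Ideal.span {d} ≤ Ideal.span {d} * I := by
      conv_lhs => rw [← hIJ]
      exact Ideal.mul_le.2 hall
    obtain ⟨z, hz, e⟩ := Ideal.mem_span_singleton_mul.1 (hle (Ideal.mem_span_singleton_self d))
    have : z = 1 := mul_left_cancel₀ hd (by rw [e, mul_one])
    exact hI.ne_top ((Ideal.eq_top_iff_one _).2 (this ▸ hz))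
  obtain ⟨j, hj, t, ht, hjt⟩ := hex
  have hdvd : ∀ g ∈ I, ∃ h, j * g = d * h := by
    intro g hg
    have : j * g ∈ Ideal.span {d} := hIJ ▸ Ideal.mul_mem_mul hj hg
    obtain ⟨h, e⟩ := Ideal.mem_span_singleton'.1 this
    exact ⟨h, by rw [← e, mul_comm]⟩
  obtain ⟨u, hu⟩ := hdvd t ht
  refine ⟨t, hI, ?_, ht, fun g hg => ?_⟩
  · rintro rfl
    exact hjt (by simp)
  · obtain ⟨h, hh⟩ := hdvd g hg
    refine ⟨u, fun hu' => hjt ?_, h, mul_left_cancel₀ hd ?_⟩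
    · rw [hu]
      exact Ideal.mul_mem_mul (Ideal.mem_span_singleton_self d) hu'
    · linear_combination -g * hu + t * hh

section Points

variable {F : Type*} [Field F] (W : WeierstrassCurve.Affine F)

/-! ### Affine points -/

theorem isMaximal_XYIdeal {x y : F} (h : W.Equation x y) :
    (CoordinateRing.XYIdeal W x (C y)).IsMaximal := by
  have e := CoordinateRing.quotientXYIdealEquiv (W' := W) (x := x) (y := C y) h
  exact Ideal.Quotient.maximal_of_isField _ (e.toMulEquiv.isField (Field.toIsField F))

/-- The vertical line through a nonsingular point cuts out the product of the ideals of the point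
and its negative, so the ideal of the point divides a nonzero principal ideal. -/
theorem exists_isUniformizer_XYIdeal {x y : F} (h : W.Nonsingular x y) :
    ∃ t, IsUniformizer (CoordinateRing.XYIdeal W x (C y)) t :=
  exists_isUniformizer (isMaximal_XYIdeal W h.1) (CoordinateRing.XClass_ne_zero x)
    (CoordinateRing.XYIdeal_neg_mul h)

instance isNoetherianRing_coordinateRing : IsNoetherianRing W.CoordinateRing :=
  inferInstanceAs (IsNoetherianRing (F[X][X] ⧸ _))

/-! ### The point at infinity -/

theorem degree_norm_le_iff (p q : F[X]) (m : ℕ) :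
    (Algebra.norm F[X] (p • (1 : W.CoordinateRing) + q • CoordinateRing.mk W X)).natDegree ≤ m ↔
      2 • p.degree ≤ m ∧ 2 • q.degree + 3 ≤ m := by
  rw [natDegree_le_iff_degree_le, CoordinateRing.degree_norm_smul_basis, max_le_iff]

/-- Minus the order of the pole at infinity of an element of the coordinate ring. -/
noncomputable def inftyDegree (g : W.CoordinateRing) : ℤ :=
  -((Algebra.norm F[X] g).natDegree : ℤ)

/-- Additivity is multiplicativity of the norm. The ultrametric inequality comes from the formula
`max (2 deg p) (2 deg q + 3)` for the degree of the norm of `p + q y`. -/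
theorem isOrder_inftyDegree : IsOrder (inftyDegree W) where
  mul {f g} hf hg := by
    have hne : ∀ f : W.CoordinateRing, f ≠ 0 → Algebra.norm F[X] f ≠ 0 :=
      fun f hf => (Algebra.norm_ne_zero_iff_of_basis (CoordinateRing.basis W)).2 hf
    rw [inftyDegree, map_mul, natDegree_mul (hne f hf) (hne g hg), inftyDegree, inftyDegree]
    push_cast
    ring
  add {f g n} _ _ _ hf hg := by
    obtain ⟨p, q, rfl⟩ := CoordinateRing.exists_smul_basis_eq f
    obtain ⟨p', q', rfl⟩ := CoordinateRing.exists_smul_basis_eq g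
    rw [inftyDegree] at *
    obtain ⟨m, rfl⟩ : ∃ m : ℕ, n = -(m : ℤ) := ⟨(-n).toNat, by lia⟩
    rw [neg_le_neg_iff, Nat.cast_le, degree_norm_le_iff] at hf hg
    have e : p • (1 : W.CoordinateRing) + q • CoordinateRing.mk W X +
        (p' • (1 : W.CoordinateRing) + q' • CoordinateRing.mk W X) =
        (p + p') • (1 : W.CoordinateRing) + (q + q') • CoordinateRing.mk W X := by
      rw [add_smul, add_smul]
      abel
    rw [e, neg_le_neg_iff, Nat.cast_le, degree_norm_le_iff]
    constructor
    · rcases le_max_iff.1 (degree_add_le p p') with h | h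
      · exact (nsmul_le_nsmul_right h 2).trans hf.1
      · exact (nsmul_le_nsmul_right h 2).trans hg.1
    · rcases le_max_iff.1 (degree_add_le q q') with h | h
      · exact (add_le_add_left (nsmul_le_nsmul_right h 2) 3).trans hf.2
      · exact (add_le_add_left (nsmul_le_nsmul_right h 2) 3).trans hg.2

/-- The order of vanishing at infinity, defined by means of degrees. -/
noncomputable def inftyOrder : W.FunctionField → ℤ :=
  extendOrder (inftyDegree W)

theorem isOrder_inftyOrder : IsOrder (inftyOrder W) :=
  isOrder_extendOrder (isOrder_inftyDegree W)

theorem inftyOrder_algebraMap {g : W.CoordinateRing} (hg : g ≠ 0) :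
    inftyOrder W (algebraMap _ _ g) = inftyDegree W g :=
  extendOrder_algebraMap (isOrder_inftyDegree W) hg

theorem inftyDegree_C {p : F[X]} : inftyDegree W (CoordinateRing.mk W (C p)) = -(2 * p.natDegree) := by
  have h := CoordinateRing.norm_smul_basis (W' := W) p 0
  have e : p • (1 : W.CoordinateRing) + (0 : F[X]) • CoordinateRing.mk W X =
      CoordinateRing.mk W (C p) := by
    rw [zero_smul, add_zero, CoordinateRing.smul, mul_one]
  rw [e] at h
  rw [inftyDegree, h]
  simp

theorem inftyDegree_sub_C {p : F[X]} (hp : p.natDegree ≤ 1) :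
    inftyDegree W (CoordinateRing.mk W (X - C p)) = -3 := by
  have h := CoordinateRing.degree_norm_smul_basis (W' := W) (-p) 1
  have e : (-p) • (1 : W.CoordinateRing) + (1 : F[X]) • CoordinateRing.mk W X =
      CoordinateRing.mk W (X - C p) := by
    rw [CoordinateRing.smul, CoordinateRing.smul]
    simp only [map_neg, map_sub, map_one]
    ring
  have hle : 2 • (-p).degree ≤ 2 • (1 : F[X]).degree + 3 := by
    rw [degree_neg, degree_one]
    refine (nsmul_le_nsmul_right (degree_le_of_natDegree_le hp) 2).trans ?_
    simp only [nsmul_zero, zero_add]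
    rw [two_nsmul]
    exact_mod_cast (by norm_num : 1 + 1 ≤ 3)
  rw [e, max_eq_right hle, degree_one, nsmul_zero, zero_add] at h
  rw [inftyDegree, natDegree_eq_of_degree_eq_some (n := 3) h]
  rfl

theorem xFun_ne_zero : xFun W ≠ 0 := by
  simpa using xFun_ne_algebraMap W 0

theorem inftyOrder_xFun_sub (c : F) :
    inftyOrder W (xFun W - algebraMap F W.FunctionField c) = -2 := by
  have e : xFun W - algebraMap F W.FunctionField c =
      algebraMap W.CoordinateRing _ (CoordinateRing.mk W (C (X - C c))) := by
    rw [C_sub, map_sub, map_sub]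
    rfl
  have hne : CoordinateRing.mk W (C (X - C c)) ≠ 0 := CoordinateRing.XClass_ne_zero c
  rw [e, inftyOrder_algebraMap W hne, inftyDegree_C, natDegree_X_sub_C]
  rfl

theorem inftyOrder_xFun : inftyOrder W (xFun W) = -2 := by
  simpa using inftyOrder_xFun_sub W 0

theorem inftyOrder_yFun : inftyOrder W (yFun W) = -3 := by
  have h := inftyDegree_sub_C W (p := 0) (by simp)
  rw [C_0, sub_zero] at h
  rw [← h]
  refine inftyOrder_algebraMap W ?_
  simpa [CoordinateRing.YClass] using CoordinateRing.YClass_ne_zero (W' := W) (0 : F[X])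

theorem equation_functions :
    yFun W ^ 2 + algebraMap F _ W.a₁ * xFun W * yFun W + algebraMap F _ W.a₃ * yFun W =
      xFun W ^ 3 + algebraMap F _ W.a₂ * xFun W ^ 2 + algebraMap F _ W.a₄ * xFun W +
        algebraMap F _ W.a₆ :=
  ((W⁄W.FunctionField).equation_iff _ _).1 (equation_xFun_yFun W)

/-- An order function on the function field with `x/y` and `1/y` of positive order is nonnegative
on the chart at infinity, and positive on the ideal of the point at infinity. -/
theorem orderGE_of_mem_inftyRing {v : W.FunctionField → ℤ} (hv : IsOrder v)
    (hc : ∀ c : F, OrderGE v 0 (algebraMap F W.FunctionField c))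
    (ht : OrderGE v 1 (xFun W / yFun W)) (hw : OrderGE v 1 (1 / yFun W)) :
    (∀ g : inftyRing W, OrderGE v 0 (algebraMap _ W.FunctionField g)) ∧
      ∀ g ∈ inftyIdeal W, OrderGE v 1 (algebraMap _ W.FunctionField g) := by
  have h0 : ∀ g : inftyRing W, OrderGE v 0 (algebraMap _ W.FunctionField g) := by
    rintro ⟨g, hg⟩
    change g ∈ hv.subring
    induction hg using Algebra.adjoin_induction with
    | mem f hf =>
      rcases hf with rfl | rfl
      · exact fun h => zero_le_one.trans (ht h)
      · exact fun h => zero_le_one.trans (hw h)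
    | algebraMap c => exact hc c
    | add f g _ _ hf hg => exact add_mem hf hg
    | mul f g _ _ hf hg => exact mul_mem hf hg
  refine ⟨h0, fun g hg => ?_⟩
  obtain ⟨a, b, rfl⟩ := Ideal.mem_span_pair.1 hg
  rw [map_add, map_mul, map_mul]
  exact hv.orderGE_add (hv.orderGE_mul (h0 a) ht) (hv.orderGE_mul (h0 b) hw)

theorem inftyOrder_pos :
    (∀ g : inftyRing W, OrderGE (inftyOrder W) 0 (algebraMap _ W.FunctionField g)) ∧
      ∀ g ∈ inftyIdeal W, OrderGE (inftyOrder W) 1 (algebraMap _ W.FunctionField g) := by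
  have hv := isOrder_inftyOrder W
  refine orderGE_of_mem_inftyRing W hv (fun c hc => ?_) (fun _ => ?_) (fun _ => ?_)
  · have e : algebraMap F W.FunctionField c =
      algebraMap W.CoordinateRing _ (CoordinateRing.mk W (C (C c))) := rfl
    rw [e] at hc ⊢
    rw [inftyOrder_algebraMap W (by rintro h; rw [h, map_zero] at hc; exact hc rfl), inftyDegree_C]
    simp
  · rw [hv.div (xFun_ne_zero W) (yFun_ne_zero W), inftyOrder_xFun, inftyOrder_yFun]
    norm_num
  · rw [hv.div one_ne_zero (yFun_ne_zero W), hv.one, inftyOrder_yFun]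
    norm_num

instance isNoetherianRing_inftyRing : IsNoetherianRing (inftyRing W) :=
  isNoetherianRing_of_fg (Subalgebra.fg_def.2 ⟨_, Set.toFinite _, rfl⟩)

/-- The function `x/y` as an element of the chart at infinity. -/
noncomputable def inftyParam : inftyRing W :=
  ⟨xFun W / yFun W, Algebra.subset_adjoin (by simp)⟩

/-- The function `1/y` as an element of the chart at infinity. -/
noncomputable def inftyInv : inftyRing W :=
  ⟨1 / yFun W, Algebra.subset_adjoin (by simp)⟩

theorem one_notMem_inftyIdeal : (1 : inftyRing W) ∉ inftyIdeal W := by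
  intro h
  have := (inftyOrder_pos W).2 1 h (by simp)
  rw [map_one, (isOrder_inftyOrder W).one] at this
  lia

theorem inftyParam_mem : inftyParam W ∈ inftyIdeal W :=
  Ideal.subset_span (Or.inl rfl)

theorem inftyInv_mem : inftyInv W ∈ inftyIdeal W :=
  Ideal.subset_span (Or.inr rfl)

/-- The residue ring at infinity consists of constants, because both generators of the chart vanish
there; this makes the ideal maximal. -/
theorem exists_sub_mem_inftyIdeal (g : inftyRing W) :
    ∃ c : F, g - algebraMap F (inftyRing W) c ∈ inftyIdeal W := by
  obtain ⟨g, hg⟩ := g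
  induction hg using Algebra.adjoin_induction with
  | mem f hf =>
    refine ⟨0, ?_⟩
    rw [map_zero, sub_zero]
    rcases hf with rfl | rfl
    exacts [inftyParam_mem W, inftyInv_mem W]
  | algebraMap c =>
    refine ⟨c, ?_⟩
    rw [show (⟨_, _⟩ : inftyRing W) = algebraMap F _ c from rfl, sub_self]
    exact zero_mem _
  | add f g hf' hg' hf hg =>
    obtain ⟨c, hc⟩ := hf
    obtain ⟨d, hd⟩ := hg
    refine ⟨c + d, ?_⟩
    convert add_mem hc hd using 1
    rw [map_add, show (⟨f + g, _⟩ : inftyRing W) = ⟨f, hf'⟩ + ⟨g, hg'⟩ from rfl]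
    ring
  | mul f g hf' hg' hf hg =>
    obtain ⟨c, hc⟩ := hf
    obtain ⟨d, hd⟩ := hg
    refine ⟨c * d, ?_⟩
    convert add_mem (Ideal.mul_mem_right ⟨g, hg'⟩ _ hc)
      (Ideal.mul_mem_left _ (algebraMap F (inftyRing W) c) hd) using 1
    rw [map_mul, show (⟨f * g, _⟩ : inftyRing W) = ⟨f, hf'⟩ * ⟨g, hg'⟩ from rfl]
    ring

theorem isMaximal_inftyIdeal : (inftyIdeal W).IsMaximal := by
  refine Ideal.isMaximal_iff.2 ⟨one_notMem_inftyIdeal W, fun J g hJ hg hgJ => ?_⟩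
  obtain ⟨c, hc⟩ := exists_sub_mem_inftyIdeal W g
  have hc0 : c ≠ 0 := by
    rintro rfl
    rw [map_zero, sub_zero] at hc
    exact hg hc
  have h1 : algebraMap F (inftyRing W) c ∈ J := by
    have := sub_mem hgJ (hJ hc)
    rwa [sub_sub_cancel] at this
  have := J.mul_mem_left (algebraMap F (inftyRing W) c⁻¹) h1
  rwa [← map_mul, inv_mul_cancel₀ hc0, map_one] at this

theorem isUniformizer_inftyParam : IsUniformizer (inftyIdeal W) (inftyParam W) where
  isMaximal := isMaximal_inftyIdeal W
  ne_zero h := div_ne_zero (xFun_ne_zero W) (yFun_ne_zero W) (congrArg Subtype.val h)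
  mem := inftyParam_mem W
  exists_mul_eq g hg := by
    set t := inftyParam W with ht
    set w := inftyInv W with hw
    let k := algebraMap F (inftyRing W)
    -- Divided by `y ^ 3`, the Weierstrass equation in `t = x/y`, `w = 1/y` reads `(1 + z) w = t ^
    -- 3` with `z` vanishing at infinity. So `w` is locally a multiple of `t`.
    obtain ⟨z, hz, e⟩ : ∃ z ∈ inftyIdeal W, (1 + z) * w = t ^ 3 := by
      refine ⟨(k W.a₁ - k W.a₂ * t - k W.a₄ * w) * t + (k W.a₃ - k W.a₆ * w) * w,
        add_mem (Ideal.mul_mem_left _ _ (inftyParam_mem W))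
          (Ideal.mul_mem_left _ _ (inftyInv_mem W)), Subtype.ext ?_⟩
      change (1 + ((algebraMap F _ W.a₁ - algebraMap F _ W.a₂ * (xFun W / yFun W) -
        algebraMap F _ W.a₄ * (1 / yFun W)) * (xFun W / yFun W) +
        (algebraMap F _ W.a₃ - algebraMap F _ W.a₆ * (1 / yFun W)) * (1 / yFun W))) *
          (1 / yFun W) = (xFun W / yFun W) ^ 3
      have := yFun_ne_zero W
      have := equation_functions W
      field_simp
      linear_combination this
    obtain ⟨a, b, rfl⟩ := Ideal.mem_span_pair.1 hg
    refine ⟨1 + z, fun hu => one_notMem_inftyIdeal W ((add_mem_cancel_right hz).1 hu),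
      (1 + z) * a + t ^ 2 * b, ?_⟩
    change (1 + z) * (a * t + b * w) = _
    linear_combination b * e

theorem inftyOrder_inftyParam : inftyOrder W (xFun W / yFun W) = 1 := by
  rw [(isOrder_inftyOrder W).div (xFun_ne_zero W) (yFun_ne_zero W), inftyOrder_xFun,
    inftyOrder_yFun]
  norm_num

/-- The order defined by degrees is centered at the point at infinity and equals `1` at `x/y`, so it
is the order of the chart. Orders at infinity can then be read off from norms. -/
theorem pointOrder_zero {f : W.FunctionField} (hf : f ≠ 0) :
    pointOrder W 0 f = inftyOrder W f :=
  ((isUniformizer_inftyParam W).eq_fracOrder (isOrder_inftyOrder W) (inftyOrder_pos W).1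
    (inftyOrder_pos W).2 ⟨_, div_ne_zero (xFun_ne_zero W) (yFun_ne_zero W),
      inftyOrder_inftyParam W⟩ hf).symm

/-! ### Orders at points -/

theorem isOrder_pointOrder (P : W.Point) : IsOrder (pointOrder W P) := by
  rcases P with _ | ⟨x, y, h⟩
  · exact (isUniformizer_inftyParam W).isOrder_fracOrder
  · obtain ⟨t, ht⟩ := exists_isUniformizer_XYIdeal W h
    exact ht.isOrder_fracOrder

theorem exists_pointOrder_eq_one (P : W.Point) : ∃ f ≠ 0, pointOrder W P f = 1 := by
  rcases P with _ | ⟨x, y, h⟩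
  · exact ⟨_, div_ne_zero (xFun_ne_zero W) (yFun_ne_zero W),
      (isUniformizer_inftyParam W).fracOrder_self⟩
  · obtain ⟨t, ht⟩ := exists_isUniformizer_XYIdeal W h
    refine ⟨algebraMap _ _ t, ?_, ht.fracOrder_self⟩
    rw [map_ne_zero_iff _ (IsFractionRing.injective W.CoordinateRing W.FunctionField)]
    exact ht.ne_zero

theorem orderGE_pointOrder_algebraMap {x y : F} (h : W.Nonsingular x y) (g : W.CoordinateRing) :
    OrderGE (pointOrder W (.some x y h)) 0 (algebraMap _ _ g) := by
  intro hg
  obtain ⟨t, ht⟩ := exists_isUniformizer_XYIdeal W h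
  have hg0 : g ≠ 0 := by rintro rfl; simp at hg
  rw [show pointOrder W (.some x y h) (algebraMap _ _ g) = adicOrder _ g from
    ht.fracOrder_algebraMap hg0]
  exact Int.natCast_nonneg _

theorem orderGE_one_pointOrder_iff {x y : F} (h : W.Nonsingular x y) (g : W.CoordinateRing) :
    OrderGE (pointOrder W (.some x y h)) 1 (algebraMap _ _ g) ↔
      g ∈ CoordinateRing.XYIdeal W x (C y) := by
  obtain ⟨t, ht⟩ := exists_isUniformizer_XYIdeal W h
  by_cases hg0 : g = 0
  · simp [hg0, OrderGE]
  have hg : algebraMap _ W.FunctionField g ≠ 0 := by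
    rwa [map_ne_zero_iff _ (IsFractionRing.injective W.CoordinateRing W.FunctionField)]
  rw [← ht.one_le_fracOrder_iff (K := W.FunctionField) hg0]
  exact ⟨fun h => h hg, fun h _ => h⟩

/-- The criterion for an order function to be the order at a given affine point. -/
theorem eq_pointOrder_some {v : W.FunctionField → ℤ} (hv : IsOrder v)
    (hc : ∀ c : F, OrderGE v 0 (algebraMap F W.FunctionField c))
    (hsurj : ∃ f ≠ 0, v f = 1) {x y : F} (h : W.Nonsingular x y)
    (hx : OrderGE v 1 (xFun W - algebraMap F _ x)) (hy : OrderGE v 1 (yFun W - algebraMap F _ y))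
    {f : W.FunctionField} (hf : f ≠ 0) : v f = pointOrder W (.some x y h) f := by
  obtain ⟨t, ht⟩ := exists_isUniformizer_XYIdeal W h
  have hle : ∀ {f : W.FunctionField} {c : F}, OrderGE v 1 (f - algebraMap F _ c) → f ∈ hv.subring := by
    intro f c hf
    have := hv.orderGE_add (n := 0) (fun h => zero_le_one.trans (hf h)) (hc c)
    rwa [sub_add_cancel] at this
  have h0 : ∀ g : W.CoordinateRing, OrderGE v 0 (algebraMap _ _ g) := by
    intro g
    change _ ∈ hv.subring
    have hg := adjoin_xFun_yFun W g
    generalize algebraMap W.CoordinateRing W.FunctionField g = z at hg ⊢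
    induction hg using Algebra.adjoin_induction with
    | mem f hf =>
      rcases hf with rfl | rfl
      exacts [hle hx, hle hy]
    | algebraMap c => exact hc c
    | add f g _ _ hf hg => exact add_mem hf hg
    | mul f g _ _ hf hg => exact mul_mem hf hg
  refine ht.eq_fracOrder hv h0 (fun g hg => ?_) hsurj hf
  obtain ⟨a, b, rfl⟩ := Ideal.mem_span_pair.1 hg
  rw [map_add, map_mul, map_mul]
  have hX : algebraMap W.CoordinateRing W.FunctionField (CoordinateRing.XClass W x) =
      xFun W - algebraMap F _ x := by
    rw [CoordinateRing.XClass, C_sub, map_sub, map_sub]; rfl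
  have hY : algebraMap W.CoordinateRing W.FunctionField (CoordinateRing.YClass W (C y)) =
      yFun W - algebraMap F _ y := by
    rw [CoordinateRing.YClass, map_sub, map_sub]; rfl
  rw [hX, hY]
  exact hv.orderGE_add (hv.orderGE_mul (h0 a) hx) (hv.orderGE_mul (h0 b) hy)

theorem eq_pointOrder_zero {v : W.FunctionField → ℤ} (hv : IsOrder v)
    (hc : ∀ c : F, OrderGE v 0 (algebraMap F W.FunctionField c))
    (hsurj : ∃ f ≠ 0, v f = 1)
    (ht : OrderGE v 1 (xFun W / yFun W)) (hw : OrderGE v 1 (1 / yFun W))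
    {f : W.FunctionField} (hf : f ≠ 0) : v f = pointOrder W 0 f :=
  have h := orderGE_of_mem_inftyRing W hv hc ht hw
  (isUniformizer_inftyParam W).eq_fracOrder hv h.1 h.2 hsurj hf

theorem orderGE_xFun_sub {x y : F} (h : W.Nonsingular x y) :
    OrderGE (pointOrder W (.some x y h)) 1 (xFun W - algebraMap F _ x) := by
  have := (orderGE_one_pointOrder_iff W h (CoordinateRing.XClass W x)).2
    (Ideal.subset_span (Or.inl rfl))
  rwa [CoordinateRing.XClass, C_sub, map_sub, map_sub] at this

theorem orderGE_yFun_sub {x y : F} (h : W.Nonsingular x y) :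
    OrderGE (pointOrder W (.some x y h)) 1 (yFun W - algebraMap F _ y) := by
  have := (orderGE_one_pointOrder_iff W h (CoordinateRing.YClass W (C y))).2
    (Ideal.subset_span (Or.inr rfl))
  rwa [CoordinateRing.YClass, map_sub, map_sub] at this

end Points

/-! ### Regular functions -/

/-- Cancelling the common power of `t` writes `f` with a denominator outside `I`: it belongs to the
local ring at `I`. -/
theorem IsUniformizer.exists_mul_eq_algebraMap {R K : Type*} [CommRing R] [IsDomain R]
    [IsNoetherianRing R] [Field K] [Algebra R K] [IsFractionRing R K] {I : Ideal R} {t : R}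
    (ht : IsUniformizer I t) {f : K} (hf0 : f ≠ 0) (hf : 0 ≤ fracOrder I f) :
    ∃ r ∉ I, ∃ g, algebraMap R K r * f = algebraMap R K g := by
  have hinj := IsFractionRing.injective R K
  obtain ⟨a, b, hb, rfl⟩ := IsFractionRing.div_surjective R f
  have hb := nonZeroDivisors.ne_zero hb
  have ha : a ≠ 0 := by rintro rfl; simp at hf0
  have hbK : algebraMap R K b ≠ 0 := by rwa [map_ne_zero_iff _ hinj]
  rw [ht.isOrder_fracOrder.div (by rwa [map_ne_zero_iff _ hinj]) hbK,
    ht.fracOrder_algebraMap ha, ht.fracOrder_algebraMap hb] at hf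
  obtain ⟨u, hu, w, hw, e⟩ := ht.exists_eq_mul_pow ha
  obtain ⟨u', hu', w', hw', e'⟩ := ht.exists_eq_mul_pow hb
  obtain ⟨m, hm⟩ := Nat.exists_eq_add_of_le (show adicOrder I b ≤ adicOrder I a by lia)
  rw [hm, pow_add] at e
  refine ⟨u * w', ht.mul_notMem hu hw', w * u' * t ^ m, ?_⟩
  have key : u * w' * a = w * u' * t ^ m * b := by
    linear_combination w' * e - w * t ^ m * e'
  rw [mul_div_assoc', div_eq_iff hbK, ← map_mul, ← map_mul, key]

section

variable {F : Type*} [Field F] (W : WeierstrassCurve.Affine F)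

instance finiteType_coordinateRing : Algebra.FiniteType F W.CoordinateRing := by
  have : Algebra.FiniteType F F[X][X] := .trans (S := F[X]) inferInstance inferInstance
  exact .of_surjective (Ideal.Quotient.mkₐ F (Ideal.span {W.polynomial}))
    (Ideal.Quotient.mkₐ_surjective _ _)

variable [IsAlgClosed F] [W.IsElliptic]

/-- Every maximal ideal of the coordinate ring is the ideal of a point. -/
theorem exists_eq_XYIdeal {M : Ideal W.CoordinateRing} (hM : M.IsMaximal) :
    ∃ (x y : F) (_ : W.Nonsingular x y), M = CoordinateRing.XYIdeal W x (C y) := by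
  let _ := Ideal.Quotient.field M
  have : Algebra.FiniteType F (W.CoordinateRing ⧸ M) :=
    .of_surjective (Ideal.Quotient.mkₐ F M) (Ideal.Quotient.mkₐ_surjective _ _)
  -- Zariski's lemma: the residue field is finite over the algebraically closed `F`, hence equal to
  -- `F`, and the residues of the coordinate functions are the coordinates of the point.
  have : Module.Finite F (W.CoordinateRing ⧸ M) := finite_of_finite_type_of_isJacobsonRing _ _
  have hbij := IsAlgClosed.algebraMap_bijective_of_isIntegral
    (k := F) (K := W.CoordinateRing ⧸ M)
  have hres : ∀ g : W.CoordinateRing, ∃ c : F, g - algebraMap F _ c ∈ M := by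
    intro g
    obtain ⟨c, hc⟩ := hbij.2 (Ideal.Quotient.mk M g)
    exact ⟨c, Ideal.Quotient.eq.1 hc.symm⟩
  obtain ⟨x, hx⟩ := hres (CoordinateRing.mk W (C X))
  obtain ⟨y, hy⟩ := hres (CoordinateRing.mk W X)
  have hle : CoordinateRing.XYIdeal W x (C y) ≤ M := by
    rw [CoordinateRing.XYIdeal, Ideal.span_le]
    rintro _ (rfl | rfl)
    · rw [CoordinateRing.XClass, C_sub, map_sub]; exact hx
    · rw [CoordinateRing.YClass, map_sub]; exact hy
  have hW : W.Equation x y := by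
    have h1 : CoordinateRing.mk W W.polynomial = 0 := AdjoinRoot.mk_self
    have hxM : Ideal.Quotient.mk M (CoordinateRing.mk W (C X)) = algebraMap F _ x :=
      Ideal.Quotient.eq.2 hx
    have hyM : Ideal.Quotient.mk M (CoordinateRing.mk W X) = algebraMap F _ y :=
      Ideal.Quotient.eq.2 hy
    have hcM : ∀ c : F, Ideal.Quotient.mk M (CoordinateRing.mk W (C (C c))) = algebraMap F _ c :=
      fun c => rfl
    have h2 := congrArg (Ideal.Quotient.mk M) h1
    simp only [WeierstrassCurve.Affine.polynomial, map_add, map_sub, map_mul, map_pow, map_zero,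
      hxM, hyM, hcM] at h2
    rw [equation_iff']
    apply hbij.1
    simp only [map_add, map_sub, map_mul, map_pow, map_zero]
    linear_combination h2
  exact ⟨x, y, equation_iff_nonsingular.1 hW,
    ((isMaximal_XYIdeal W hW).eq_of_le hM.ne_top hle).symm⟩

/-- A function without poles at affine points belongs to the coordinate ring. -/
theorem exists_algebraMap_eq {f : W.FunctionField} (hf0 : f ≠ 0)
    (hf : ∀ (x y : F) (h : W.Nonsingular x y), 0 ≤ pointOrder W (.some x y h) f) :
    ∃ g : W.CoordinateRing, algebraMap _ _ g = f := by
  -- The ideal of denominators of `f`. Regularity at each point keeps it out of every maximal ideal,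
  -- so it contains `1`.
  let D : Ideal W.CoordinateRing :=
    { carrier := {r | ∃ g : W.CoordinateRing, algebraMap _ W.FunctionField r * f = algebraMap _ _ g}
      add_mem' := by
        rintro r r' ⟨g, hg⟩ ⟨g', hg'⟩
        exact ⟨g + g', by rw [map_add, map_add, add_mul, hg, hg']⟩
      zero_mem' := ⟨0, by simp⟩
      smul_mem' := by
        rintro c r ⟨g, hg⟩
        exact ⟨c * g, by rw [smul_eq_mul, map_mul, map_mul, mul_assoc, hg]⟩ }
  have hD : D = ⊤ := by
    by_contra hD
    obtain ⟨M, hM, hDM⟩ := Ideal.exists_le_maximal D hD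
    obtain ⟨x, y, h, rfl⟩ := exists_eq_XYIdeal W hM
    obtain ⟨t, ht⟩ := exists_isUniformizer_XYIdeal W h
    obtain ⟨r, hr, hg⟩ := ht.exists_mul_eq_algebraMap hf0 (hf x y h)
    exact hr (hDM hg)
  obtain ⟨g, hg⟩ : (1 : W.CoordinateRing) ∈ D := hD ▸ Submodule.mem_top
  exact ⟨g, by rw [← hg, map_one, one_mul]⟩

/-- A function without poles is constant. -/
theorem exists_algebraMap_eq_of_pointOrder_nonneg {f : W.FunctionField} (hf0 : f ≠ 0)
    (hf : ∀ P : W.Point, 0 ≤ pointOrder W P f) : ∃ c : F, algebraMap F _ c = f := by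
  obtain ⟨g, rfl⟩ := exists_algebraMap_eq W hf0 fun x y h => hf _
  have hg : g ≠ 0 := by rintro rfl; simp at hf0
  have h0 := hf 0
  rw [pointOrder_zero W hf0, inftyOrder_algebraMap W hg] at h0
  obtain ⟨p, q, rfl⟩ := CoordinateRing.exists_smul_basis_eq g
  rw [inftyDegree] at h0
  -- No pole at infinity means `2 deg p ≤ 0` and `2 deg q + 3 ≤ 0`, so `q = 0` and `p` is constant.
  have h1 := (degree_norm_le_iff W p q 0).1 (by lia)
  have hq : q = 0 := by
    by_contra hq
    have h2 := h1.2
    rw [degree_eq_natDegree hq, two_nsmul] at h2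
    have : q.natDegree + q.natDegree + 3 ≤ 0 := by exact_mod_cast h2
    lia
  have hp : p.natDegree = 0 := by
    by_cases hp : p = 0
    · simp [hp]
    have h2 := h1.1
    rw [degree_eq_natDegree hp, two_nsmul] at h2
    have : p.natDegree + p.natDegree ≤ 0 := by exact_mod_cast h2
    lia
  obtain ⟨c, rfl⟩ := natDegree_eq_zero.1 hp
  refine ⟨c, ?_⟩
  rw [hq, zero_smul, add_zero, CoordinateRing.smul, mul_one]
  rfl

/-! ### Every normalized order function is the order at a point -/

variable {W}

omit [W.IsElliptic] in
theorem pointOrder_algebraMap {P : W.Point} {c : F} (hc : c ≠ 0) :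
    pointOrder W P (algebraMap F _ c) = 0 :=
  (isOrder_pointOrder W P).algebraMap_eq_zero hc

/-- The regular functions of positive order form a nonzero prime ideal, the center of `v`. In a
curve it is maximal, hence the ideal of a point, and a normalized order function is determined by
its center. -/
theorem exists_eq_pointOrder_some {v : W.FunctionField → ℤ} (hv : IsOrder v)
    (hsurj : ∃ f ≠ 0, v f = 1) (h0 : ∀ g : W.CoordinateRing, OrderGE v 0 (algebraMap _ _ g)) :
    ∃ P : W.Point, ∀ f ≠ 0, v f = pointOrder W P f := by
  have hinj := IsFractionRing.injective W.CoordinateRing W.FunctionField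
  let p : Ideal W.CoordinateRing :=
    { carrier := {g | OrderGE v 1 (algebraMap _ _ g)}
      add_mem' := by
        intro a b ha hb
        simp only [Set.mem_ofPred_eq, map_add] at *
        exact hv.orderGE_add ha hb
      zero_mem' := by simp [OrderGE]
      smul_mem' := by
        intro c a ha
        simp only [Set.mem_ofPred_eq, smul_eq_mul, map_mul] at *
        exact hv.orderGE_mul (h0 c) ha }
  have hp1 : (1 : W.CoordinateRing) ∉ p := by
    intro h
    have := h (by simp)
    rw [map_one, hv.one] at this
    lia
  have hprime : p.IsPrime := by
    refine Ideal.isPrime_iff.2 ⟨fun h => hp1 (h ▸ Submodule.mem_top), fun {a b} hab => ?_⟩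
    by_contra! hn
    have ha0 : algebraMap W.CoordinateRing W.FunctionField a ≠ 0 := fun h => hn.1 fun h' => absurd h h'
    have hb0 : algebraMap W.CoordinateRing W.FunctionField b ≠ 0 := fun h => hn.2 fun h' => absurd h h'
    have h1 := hab (by rw [map_mul]; exact mul_ne_zero ha0 hb0)
    rw [map_mul, hv.mul ha0 hb0] at h1
    have h2 : ¬ 1 ≤ v (algebraMap W.CoordinateRing W.FunctionField a) := fun h => hn.1 fun _ => h
    have h3 : ¬ 1 ≤ v (algebraMap W.CoordinateRing W.FunctionField b) := fun h => hn.2 fun _ => h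
    lia
  have hne : ∃ g ∈ p, g ≠ 0 := by
    obtain ⟨f, hf0, hf⟩ := hsurj
    obtain ⟨a, b, hb, rfl⟩ := IsFractionRing.div_surjective W.CoordinateRing f
    have ha : a ≠ 0 := by rintro rfl; simp at hf0
    have hbK : algebraMap W.CoordinateRing W.FunctionField b ≠ 0 := by
      rw [map_ne_zero_iff _ hinj]; exact nonZeroDivisors.ne_zero hb
    refine ⟨a, fun haK => ?_, ha⟩
    rw [hv.div haK hbK] at hf
    have := h0 b hbK
    lia
  -- The contraction to `F[X]` is a nonzero prime, hence maximal, and the coordinate ring is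
  -- integral over `F[X]`.
  have hmax : p.IsMaximal := by
    have : Module.Finite F[X] W.CoordinateRing := .of_basis (CoordinateRing.basis W)
    obtain ⟨g, hgp, hg0⟩ := hne
    obtain ⟨q, hq0, hq⟩ := exists_C_mem_span W hg0
    have hqp : q ∈ p.comap (algebraMap F[X] W.CoordinateRing) :=
      (Ideal.span_singleton_le_iff_mem p).2 hgp hq
    have : (p.comap (algebraMap F[X] W.CoordinateRing)).IsPrime := hprime.comap _
    refine Ideal.isMaximal_of_isIntegral_of_isMaximal_comap (R := F[X]) p
      (Ideal.IsPrime.isMaximal this ?_)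
    rintro h
    rw [h] at hqp
    exact hq0 hqp
  obtain ⟨x, y, h, e⟩ := exists_eq_XYIdeal W hmax
  obtain ⟨t, ht⟩ := exists_isUniformizer_XYIdeal W h
  exact ⟨.some x y h, fun f hf => ht.eq_fracOrder hv h0 (fun g hg => e.ge hg) hsurj hf⟩

/-- The sign of `v x` decides where the center lies: on the affine curve if `x` has no pole, at
infinity if it has one. -/
theorem exists_eq_pointOrder {v : W.FunctionField → ℤ} (hv : IsOrder v)
    (hsurj : ∃ f ≠ 0, v f = 1) : ∃ P : W.Point, ∀ f ≠ 0, v f = pointOrder W P f := by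
  have hc := fun c : F => hv.orderGE_algebraMap (F := F) c
  have hy0 := yFun_ne_zero W
  have hx0 := xFun_ne_zero W
  set x := xFun W
  set y := yFun W
  set k := algebraMap F W.FunctionField
  have e : y * (y + (k W.a₁ * x + k W.a₃)) =
      x ^ 3 + (k W.a₂ * x ^ 2 + (k W.a₄ * x + k W.a₆)) := by
    linear_combination equation_functions W
  rcases le_or_gt 0 (v x) with hx | hx
  · have hxO : x ∈ hv.subring := fun _ => hx
    have hcO : ∀ c, k c ∈ hv.subring := hc
    -- `y` is integral over `F[x]`: with `v y < 0` the left side of `e` would have order `2 v y <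
    -- 0`, while the right side has nonnegative order.
    have hyO : y ∈ hv.subring := by
      intro _
      by_contra! hlt
      have hz := hv.add_eq_left hy0 (g := k W.a₁ * x + k W.a₃) fun h => by
        have := add_mem (mul_mem (hcO W.a₁) hxO) (hcO W.a₃) h
        lia
      have hr : x ^ 3 + (k W.a₂ * x ^ 2 + (k W.a₄ * x + k W.a₆)) ∈ hv.subring :=
        add_mem (pow_mem hxO 3) (add_mem (mul_mem (hcO _) (pow_mem hxO 2))
          (add_mem (mul_mem (hcO _) hxO) (hcO _)))
      rw [← e] at hr
      have := hr (mul_ne_zero hy0 hz.1)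
      rw [hv.mul hy0 hz.1, hz.2] at this
      lia
    refine exists_eq_pointOrder_some hv hsurj fun g => ?_
    change _ ∈ hv.subring
    have hg := adjoin_xFun_yFun W g
    generalize algebraMap W.CoordinateRing W.FunctionField g = z at hg ⊢
    induction hg using Algebra.adjoin_induction with
    | mem f hf =>
      rcases hf with rfl | rfl
      exacts [hxO, hyO]
    | algebraMap c => exact hc c
    | add f g _ _ hf hg => exact add_mem hf hg
    | mul f g _ _ hf hg => exact mul_mem hf hg
  · have hx1 : OrderGE v (v x) x := fun _ => le_rfl
    have hx2 : OrderGE v (v x + v x) (x ^ 2) := by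
      rw [pow_two]; exact hv.orderGE_mul hx1 hx1
    have hc1 : ∀ n ≤ 0, ∀ c, OrderGE v n (k c) := fun n hn c h => hn.trans (hc c h)
    have hx3 : v (x ^ 3) = 3 * v x := by rw [hv.pow hx0]; rfl
    have hr := hv.add_eq_left (pow_ne_zero 3 hx0)
      (g := k W.a₂ * x ^ 2 + (k W.a₄ * x + k W.a₆)) <| by
      have h2 : OrderGE v (v x + v x) (k W.a₂ * x ^ 2) := by
        simpa using hv.orderGE_mul (hc W.a₂) hx2
      have h4 : OrderGE v (v x + v x) (k W.a₄ * x) := by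
        refine fun h => le_trans ?_ (hv.orderGE_mul (hc W.a₄) hx1 h)
        lia
      refine fun h => le_trans ?_
        (hv.orderGE_add h2 (hv.orderGE_add h4 (hc1 _ (by lia) W.a₆)) h)
      lia
    -- Otherwise the left side of `e` has order at least `2 v x`, but the cubic term gives the right
    -- side order `3 v x < 2 v x`. The inequality makes both `x/y` and `1/y` vanish at the center.
    have hyx : v y < v x := by
      by_contra! hle
      have hy1 : OrderGE v (v x) y := fun _ => hle
      have h1 : OrderGE v (v x) (k W.a₁ * x) := by simpa using hv.orderGE_mul (hc W.a₁) hx1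
      have hz := hv.orderGE_mul hy1 (hv.orderGE_add hy1 (hv.orderGE_add h1 (hc1 _ (by lia) W.a₃)))
      rw [e] at hz
      have := hz hr.1
      lia
    refine ⟨0, fun f hf => eq_pointOrder_zero W hv hc hsurj (fun _ => ?_) (fun _ => ?_) hf⟩
    · rw [hv.div hx0 hy0]
      lia
    · rw [hv.div one_ne_zero hy0, hv.one]
      lia

omit [W.IsElliptic] in
/-- Points are determined by the order functions. -/
theorem pointOrder_injective {P Q : W.Point}
    (h : ∀ f ≠ 0, pointOrder W P f = pointOrder W Q f) : P = Q := by
  have hzero : ∀ {x y : F} (hP : W.Nonsingular x y),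
      ¬ ∀ f ≠ 0, pointOrder W (.some x y hP) f = pointOrder W 0 f := by
    intro x y hP h
    have h1 := h _ (xFun_ne_zero W)
    rw [pointOrder_zero W (xFun_ne_zero W), inftyOrder_xFun] at h1
    have := orderGE_pointOrder_algebraMap W hP (CoordinateRing.mk W (C X)) (xFun_ne_zero W)
    change 0 ≤ pointOrder W _ (xFun W) at this
    lia
  have hsub : ∀ {R : W.Point} {f : W.FunctionField} {c d : F},
      OrderGE (pointOrder W R) 1 (f - algebraMap F _ c) →
      OrderGE (pointOrder W R) 1 (f - algebraMap F _ d) → c = d := by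
    intro R f c d hc hd
    by_contra hne
    have h1 := (isOrder_pointOrder W R).orderGE_sub hd hc
    rw [sub_sub_sub_cancel_left, ← map_sub] at h1
    have h2 := h1 ((_root_.map_ne_zero _).2 (sub_ne_zero.2 hne))
    rw [pointOrder_algebraMap (sub_ne_zero.2 hne)] at h2
    lia
  rcases P with _ | ⟨x, y, hP⟩ <;> rcases Q with _ | ⟨x', y', hQ⟩
  · rfl
  · exact absurd (fun f hf => (h f hf).symm) (hzero hQ)
  · exact absurd h (hzero hP)
  · have hge : ∀ {f}, OrderGE (pointOrder W (.some x' y' hQ)) 1 f →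
        OrderGE (pointOrder W (.some x y hP)) 1 f := fun hf hf0 => (hf hf0).trans (h _ hf0).ge
    obtain rfl := hsub (orderGE_xFun_sub W hP) (hge (orderGE_xFun_sub W hQ))
    obtain rfl := hsub (orderGE_yFun_sub W hP) (hge (orderGE_yFun_sub W hQ))
    rfl

end

/-! ### Orders of ideals -/

/-- The order of an ideal with respect to an order function. -/
def HasIdealOrder {R K : Type*} [CommRing R] [Field K] [Algebra R K] (v : K → ℤ) (J : Ideal R)
    (n : ℤ) : Prop :=
  (∀ g ∈ J, OrderGE v n (algebraMap R K g)) ∧ ∃ g ∈ J, algebraMap R K g ≠ 0 ∧ v (algebraMap R K g) = n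

namespace HasIdealOrder

variable {R K : Type*} [CommRing R] [Field K] [Algebra R K] {v : K → ℤ}

theorem unique {J : Ideal R} {m n : ℤ} (hm : HasIdealOrder v J m) (hn : HasIdealOrder v J n) :
    m = n := by
  obtain ⟨hm, g, hg, hg0, rfl⟩ := hm
  obtain ⟨hn, h, hh, hh0, rfl⟩ := hn
  exact le_antisymm (hm h hh hh0) (hn g hg hg0)

theorem mul (hv : IsOrder v) {I J : Ideal R} {m n : ℤ} (hm : HasIdealOrder v I m)
    (hn : HasIdealOrder v J n) : HasIdealOrder v (I * J) (m + n) := by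
  obtain ⟨hm, g, hg, hg0, rfl⟩ := hm
  obtain ⟨hn, h, hh, hh0, rfl⟩ := hn
  refine ⟨fun z hz => ?_, g * h, Ideal.mul_mem_mul hg hh, ?_, ?_⟩
  · induction hz using Submodule.mul_induction_on' with
    | mem_mul_mem a ha b hb =>
      rw [map_mul]
      exact hv.orderGE_mul (hm a ha) (hn b hb)
    | add a _ b _ ha hb =>
      rw [map_add]
      exact hv.orderGE_add ha hb
  · rw [map_mul]
    exact mul_ne_zero hg0 hh0
  · rw [map_mul, hv.mul hg0 hh0]

theorem span_singleton (hv : IsOrder v) (h0 : ∀ g : R, OrderGE v 0 (algebraMap R K g)) {g : R}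
    (hg : algebraMap R K g ≠ 0) : HasIdealOrder v (Ideal.span {g}) (v (algebraMap R K g)) := by
  refine ⟨fun z hz => ?_, g, Ideal.mem_span_singleton_self g, hg, rfl⟩
  obtain ⟨c, rfl⟩ := Ideal.mem_span_singleton'.1 hz
  rw [map_mul]
  simpa using hv.orderGE_mul (h0 c) (fun _ => le_refl (v (algebraMap R K g)))

end HasIdealOrder

/-- The degree of a divisor. -/
noncomputable def divisorDegree {G : Type*} : (G →₀ ℤ) →+ ℤ :=
  Finsupp.liftAddHom fun _ => AddMonoidHom.id ℤ

@[simp] theorem divisorDegree_single {G : Type*} (P : G) (n : ℤ) :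
    divisorDegree (.single P n) = n := by
  simp [divisorDegree]

/-- The sum of a divisor in the group of points. -/
noncomputable def divisorSum {G : Type*} [AddCommGroup G] : (G →₀ ℤ) →+ G :=
  Finsupp.liftAddHom fun P => zmultiplesHom G P

@[simp] theorem divisorSum_single {G : Type*} [AddCommGroup G] (P : G) (n : ℤ) :
    divisorSum (.single P n) = n • P := by
  simp [divisorSum]

/-! ### Divisors of functions and lines on the curve -/

section

variable {F : Type*} [Field F] {W : WeierstrassCurve.Affine F}

theorem pointOrder_mul (P : W.Point) {f g : W.FunctionField} (hf : f ≠ 0) (hg : g ≠ 0) :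
    pointOrder W P (f * g) = pointOrder W P f + pointOrder W P g :=
  (isOrder_pointOrder W P).mul hf hg

theorem divisor_apply (a : W.FunctionFieldˣ) (P : W.Point) : divisor W a P = pointOrder W P a := rfl

theorem divisor_one : divisor W 1 = 0 :=
  Finsupp.ext fun P => (isOrder_pointOrder W P).one

theorem divisor_mul (a b : W.FunctionFieldˣ) : divisor W (a * b) = divisor W a + divisor W b :=
  Finsupp.ext fun P => pointOrder_mul P a.ne_zero b.ne_zero

theorem divisor_div (a b : W.FunctionFieldˣ) : divisor W (a / b) = divisor W a - divisor W b := by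
  rw [eq_sub_iff_add_eq, ← divisor_mul, div_mul_cancel]

theorem divisor_inv (a : W.FunctionFieldˣ) : divisor W a⁻¹ = -divisor W a := by
  rw [← one_div, divisor_div, divisor_one, zero_sub]

variable (W) in
/-- The divisor map as a homomorphism. -/
noncomputable def divisorHom : Additive W.FunctionFieldˣ →+ (W.Point →₀ ℤ) where
  toFun a := divisor W a.toMul
  map_zero' := divisor_one
  map_add' a b := divisor_mul a.toMul b.toMul

/-- A nonzero element of the coordinate ring as a unit of the function field. -/
noncomputable def toUnit (g : W.CoordinateRing) (hg : g ≠ 0) : W.FunctionFieldˣ :=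
  Units.mk0 (algebraMap _ _ g)
    (by rwa [map_ne_zero_iff _ (IsFractionRing.injective W.CoordinateRing W.FunctionField)])

theorem val_toUnit (g : W.CoordinateRing) (hg : g ≠ 0) :
    (toUnit g hg : W.FunctionField) = algebraMap _ _ g := rfl

theorem divisor_toUnit_zero (g : W.CoordinateRing) (hg : g ≠ 0) :
    divisor W (toUnit g hg) 0 = inftyDegree W g := by
  rw [divisor_apply, pointOrder_zero W (toUnit g hg).ne_zero]
  exact inftyOrder_algebraMap W hg

theorem hasIdealOrder_span {x y : F} (h : W.Nonsingular x y) {g : W.CoordinateRing} (hg : g ≠ 0) :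
    HasIdealOrder (pointOrder W (.some x y h)) (Ideal.span {g})
      (pointOrder W (.some x y h) (algebraMap _ _ g)) :=
  .span_singleton (isOrder_pointOrder W _) (orderGE_pointOrder_algebraMap W h)
    (by rwa [map_ne_zero_iff _ (IsFractionRing.injective W.CoordinateRing W.FunctionField)])

variable [IsAlgClosed F]

/-- Turns identities between products of point ideals into identities between divisors on the affine
part. Away from the point, distinct maximal ideals supply an element of order `0`. -/
theorem hasIdealOrder_XYIdeal {x y : F} (hP : W.Nonsingular x y) {x' y' : F}
    (hQ : W.Nonsingular x' y') :
    HasIdealOrder (pointOrder W (.some x' y' hQ)) (CoordinateRing.XYIdeal W x (C y))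
      (Finsupp.single (Point.some x y hP) (1 : ℤ) (.some x' y' hQ)) := by
  classical
  have hinj := IsFractionRing.injective W.CoordinateRing W.FunctionField
  obtain ⟨t, ht⟩ := exists_isUniformizer_XYIdeal W hQ
  by_cases hPQ : Point.some x y hP = .some x' y' hQ
  · rw [hPQ, Finsupp.single_eq_same]
    injection hPQ with hx hy
    subst hx hy
    exact ⟨fun g hg => (orderGE_one_pointOrder_iff W hQ g).2 hg, t, ht.mem,
      by rw [map_ne_zero_iff _ hinj]; exact ht.ne_zero, ht.fracOrder_self⟩
  · rw [Finsupp.single_eq_of_ne' hPQ]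
    refine ⟨fun g _ => orderGE_pointOrder_algebraMap W hQ g, ?_⟩
    obtain ⟨g, hg, hgQ⟩ : ∃ g ∈ CoordinateRing.XYIdeal W x (C y),
        g ∉ CoordinateRing.XYIdeal W x' (C y') := by
      by_contra! hle
      have e := (isMaximal_XYIdeal W hP.1).eq_of_le (isMaximal_XYIdeal W hQ.1).ne_top hle
      refine hPQ (pointOrder_injective fun f _ => ?_)
      simp only [pointOrder, e]
    have hg0 : algebraMap W.CoordinateRing W.FunctionField g ≠ 0 := by
      rw [map_ne_zero_iff _ hinj]
      rintro rfl
      exact hgQ (zero_mem _)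
    refine ⟨g, hg, hg0, ?_⟩
    have h1 := orderGE_pointOrder_algebraMap W hQ g hg0
    by_contra hne
    exact hgQ ((orderGE_one_pointOrder_iff W hQ g).1 fun _ => by lia)

/-- The affine part is the factorization of the vertical line into the ideals of a point and its
negative; the double pole at infinity is the degree of the norm. -/
theorem divisor_XClass {x y : F} (h : W.Nonsingular x y) :
    divisor W (toUnit (CoordinateRing.XClass W x) (CoordinateRing.XClass_ne_zero x)) =
      Finsupp.single (.some x y h) 1 + Finsupp.single (-.some x y h) 1 - Finsupp.single 0 2 := by
  classical
  ext Q
  rcases Q with _ | ⟨x', y', hQ⟩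
  · refine (divisor_toUnit_zero _ _).trans ?_
    have e : CoordinateRing.XClass W x = CoordinateRing.mk W (C (X - C x)) := rfl
    rw [e, inftyDegree_C, natDegree_X_sub_C, Finsupp.sub_apply, Finsupp.add_apply, Point.neg_some,
      ← Point.zero_def, Finsupp.single_eq_same, Finsupp.single_eq_of_ne (Point.some_ne_zero _).symm,
      Finsupp.single_eq_of_ne (Point.some_ne_zero _).symm]
    rfl
  · have h1 := (hasIdealOrder_XYIdeal ((nonsingular_neg _ _).2 h) hQ).mul (isOrder_pointOrder W _)
      (hasIdealOrder_XYIdeal h hQ)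
    rw [CoordinateRing.XYIdeal_neg_mul h] at h1
    refine ((hasIdealOrder_span hQ (CoordinateRing.XClass_ne_zero x)).unique h1).trans ?_
    rw [Finsupp.sub_apply, Finsupp.add_apply, Point.neg_some,
      Finsupp.single_eq_of_ne (a := (0 : W.Point)) (Point.some_ne_zero _), sub_zero, add_comm]

variable [DecidableEq F]

/-- The divisor of the quotient of a chord (or tangent) and a vertical line. -/
theorem exists_divisor_eq_of_add {x₁ y₁ x₂ y₂ : F} (h₁ : W.Nonsingular x₁ y₁)
    (h₂ : W.Nonsingular x₂ y₂) (hxy : ¬(x₁ = x₂ ∧ y₁ = W.negY x₂ y₂)) :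
    ∃ g, divisor W g = Finsupp.single (.some x₁ y₁ h₁) 1 + Finsupp.single (.some x₂ y₂ h₂) 1 -
      Finsupp.single (.some x₁ y₁ h₁ + .some x₂ y₂ h₂) 1 - Finsupp.single 0 1 := by
  classical
  -- In terms of ideals: (vertical line through the sum) times the ideals of both points equals
  -- (chord) times the ideal of the sum.
  have key := CoordinateRing.XYIdeal_mul_XYIdeal h₁.1 h₂.1 hxy
  have h₃ := nonsingular_add h₁ h₂ hxy
  rw [Point.add_some hxy]
  set x₃ := W.addX x₁ x₂ (W.slope x₁ x₂ y₁ y₂)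
  set y₃ := W.addY x₁ x₂ y₁ (W.slope x₁ x₂ y₁ y₂)
  set l := linePolynomial x₁ y₁ (W.slope x₁ x₂ y₁ y₂) with hl
  have hX := CoordinateRing.XClass_ne_zero (W' := W) x₃
  have hY := CoordinateRing.YClass_ne_zero (W' := W) l
  refine ⟨toUnit _ hY / toUnit _ hX, ?_⟩
  rw [divisor_div]
  ext Q
  simp only [Finsupp.sub_apply, Finsupp.add_apply]
  rcases Q with _ | ⟨x', y', hQ⟩
  -- At infinity the chord has order `-3` and the vertical line `-2`, which leaves a simple pole.
  · rw [← Point.zero_def, divisor_toUnit_zero, divisor_toUnit_zero, Finsupp.single_eq_same,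
      Finsupp.single_eq_of_ne (Point.some_ne_zero _).symm,
      Finsupp.single_eq_of_ne (Point.some_ne_zero _).symm,
      Finsupp.single_eq_of_ne (Point.some_ne_zero _).symm,
      CoordinateRing.XClass, CoordinateRing.YClass, inftyDegree_C, natDegree_X_sub_C,
      inftyDegree_sub_C W (p := l)]
    · rfl
    · rw [hl, linePolynomial]
      compute_degree
  · have hv := isOrder_pointOrder W (.some x' y' hQ)
    have e1 := (hasIdealOrder_span hQ hX).mul hv ((hasIdealOrder_XYIdeal h₁ hQ).mul hv
      (hasIdealOrder_XYIdeal h₂ hQ))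
    have e2 := (hasIdealOrder_span hQ hY).mul hv (hasIdealOrder_XYIdeal h₃ hQ)
    have e3 := e1.unique (key ▸ e2 : HasIdealOrder _ _ _)
    rw [Finsupp.single_eq_of_ne (a := (0 : W.Point)) (Point.some_ne_zero _)]
    rw [divisor_apply, divisor_apply, val_toUnit, val_toUnit]
    lia

/-- This relation makes the group law visible on divisor classes. The chord construction misses only
a summand `0`, where a constant works, and opposite points, where the vertical line works. -/
theorem exists_divisor_eq_single_add (P Q : W.Point) :
    ∃ g, divisor W g = Finsupp.single P 1 + Finsupp.single Q 1 - Finsupp.single (P + Q) 1 -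
      Finsupp.single 0 1 := by
  rcases P with _ | ⟨x₁, y₁, h₁⟩
  · refine ⟨1, ?_⟩
    rw [divisor_one, ← Point.zero_def, zero_add]
    abel
  rcases Q with _ | ⟨x₂, y₂, h₂⟩
  · refine ⟨1, ?_⟩
    rw [divisor_one, ← Point.zero_def, add_zero]
    abel
  by_cases hxy : x₁ = x₂ ∧ y₁ = W.negY x₂ y₂
  · obtain ⟨rfl, rfl⟩ := hxy
    refine ⟨_, (divisor_XClass h₂).trans ?_⟩
    rw [Point.add_of_Y_eq rfl rfl, Point.neg_some, show (2 : ℤ) = 1 + 1 from rfl, Finsupp.single_add]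
    abel
  · exact exists_divisor_eq_of_add h₁ h₂ hxy

/-! ### Principal divisors -/

/-- Every divisor `D` is equivalent to `[S] + (deg D - 1) [0]`, where `S` is the sum of `D`. -/
theorem sub_single_mem_range (D : W.Point →₀ ℤ) :
    D - Finsupp.single (divisorSum D) 1 - Finsupp.single 0 (divisorDegree D - 1) ∈
      (divisorHom W).range := by
  have hadd : ∀ P Q : W.Point, Finsupp.single P 1 + Finsupp.single Q 1 - Finsupp.single (P + Q) 1 -
      Finsupp.single 0 1 ∈ (divisorHom W).range := fun P Q => by
    obtain ⟨g, hg⟩ := exists_divisor_eq_single_add P Q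
    exact ⟨.ofMul g, hg⟩
  induction D using Finsupp.induction_linear with
  | zero =>
    convert zero_mem (divisorHom W).range using 1
    simp
  | add D E hD hE =>
    -- Replacing `[S] + [T]` by `[S + T] + [0]` costs exactly one line relation.
    convert add_mem (add_mem hD hE) (hadd (divisorSum D) (divisorSum E)) using 1
    rw [map_add, map_add, show divisorDegree D + divisorDegree E - 1 =
      (divisorDegree D - 1) + (divisorDegree E - 1) + 1 by ring, Finsupp.single_add, Finsupp.single_add]
    abel
  | single P n =>
    rw [divisorSum_single, divisorDegree_single]
    induction n using Int.induction_on with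
    | zero =>
      convert zero_mem (divisorHom W).range using 1
      simp
    | succ n ih =>
      convert add_mem ih (hadd ((n : ℤ) • P) P) using 1
      rw [add_zsmul, one_zsmul, show (n : ℤ) + 1 - 1 = (n : ℤ) - 1 + 1 by ring]
      simp only [Finsupp.single_add]
      abel
    | pred n ih =>
      convert sub_mem ih (hadd ((-(n : ℤ) - 1) • P) P) using 1
      rw [show (-(n : ℤ) - 1) • P + P = -(n : ℤ) • P by rw [← add_one_zsmul, sub_add_cancel]]
      simp only [Finsupp.single_sub]
      abel

/-- A divisor of degree `0` and with sum `0` is principal. -/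
theorem exists_divisor_eq {D : W.Point →₀ ℤ} (hdeg : divisorDegree D = 0) (hsum : divisorSum D = 0) :
    ∃ g, divisor W g = D := by
  obtain ⟨g, hg⟩ := sub_single_mem_range D
  refine ⟨g.toMul, Eq.trans hg ?_⟩
  rw [hdeg, hsum, sub_sub, ← Finsupp.single_add]
  simp

variable [W.IsElliptic]

omit [DecidableEq F] in
theorem exists_eq_const_of_divisor_eq_zero {g : W.FunctionFieldˣ} (h : divisor W g = 0) :
    ∃ c : Fˣ, algebraMap F W.FunctionField c = g := by
  obtain ⟨c, hc⟩ := exists_algebraMap_eq_of_pointOrder_nonneg W g.ne_zero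
    fun P => (DFunLike.congr_fun h P).ge
  have hc0 : c ≠ 0 := by
    rintro rfl
    rw [map_zero] at hc
    exact g.ne_zero hc.symm
  exact ⟨Units.mk0 c hc0, hc⟩

/-- The converse half of Abel's theorem. For affine `S`, the function `g` is regular and generates
the ideal of `S`, so `S` has trivial ideal class and must be `0`, since `Point.toClass` is
injective. -/
theorem eq_zero_of_divisor_eq_single_add {g : W.FunctionFieldˣ} {S : W.Point} {m : ℤ}
    (h : divisor W g = Finsupp.single S 1 + Finsupp.single 0 m) : S = 0 ∧ m = -1 := by
  classical
  have hinj := IsFractionRing.injective W.CoordinateRing W.FunctionField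
  have hS : S = 0 := by
    rcases S with _ | ⟨x, y, hP⟩
    · rfl
    have hord : ∀ (x' y' : F) (hQ : W.Nonsingular x' y'), pointOrder W (.some x' y' hQ) g =
        Finsupp.single (Point.some x y hP) (1 : ℤ) (.some x' y' hQ) := by
      intro x' y' hQ
      rw [← divisor_apply, h, Finsupp.add_apply,
        Finsupp.single_eq_of_ne (a := (0 : W.Point)) (Point.some_ne_zero _), add_zero]
    obtain ⟨r, hr⟩ := exists_algebraMap_eq W g.ne_zero fun x' y' hQ => by
      rw [hord, Finsupp.single_apply]
      split_ifs <;> norm_num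
    have hr0 : r ≠ 0 := by
      rintro rfl
      rw [map_zero] at hr
      exact g.ne_zero hr.symm
    -- For `b` in the ideal of `S`, the quotient `b / g` has no affine poles and so is regular.
    have hspan : CoordinateRing.XYIdeal W x (C y) = Ideal.span {r} := by
      refine le_antisymm (fun b hb => ?_) ?_
      · by_cases hb0 : b = 0
        · rw [hb0]; exact zero_mem _
        have hbK : algebraMap W.CoordinateRing W.FunctionField b ≠ 0 := by
          rwa [map_ne_zero_iff _ hinj]
        obtain ⟨q, hq⟩ := exists_algebraMap_eq W (div_ne_zero hbK g.ne_zero) fun x' y' hQ => by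
          rw [(isOrder_pointOrder W _).div hbK g.ne_zero, hord]
          have := (hasIdealOrder_XYIdeal hP hQ).1 b hb hbK
          lia
        rw [eq_div_iff g.ne_zero, ← hr, ← map_mul] at hq
        exact Ideal.mem_span_singleton'.2 ⟨q, hinj hq⟩
      · rw [Ideal.span_singleton_le_iff_mem, ← orderGE_one_pointOrder_iff W hP, hr]
        intro _
        rw [hord, Finsupp.single_eq_same]
    rw [← Point.toClass_eq_zero, Point.toClass_some]
    exact (ClassGroup.mk_eq_one_of_coe_ideal (CoordinateRing.XYIdeal'_eq hP)).2 ⟨r, hr0, hspan⟩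
  subst hS
  refine ⟨rfl, ?_⟩
  rw [← Finsupp.single_add] at h
  have hord : ∀ (x' y' : F) (hQ : W.Nonsingular x' y'), divisor W g (.some x' y' hQ) = 0 := by
    intro x' y' hQ
    rw [h, Finsupp.single_eq_of_ne (a := (0 : W.Point)) (Point.some_ne_zero _)]
  -- A function without affine zeros and poles is regular, so its order at infinity is at most `0`.
  -- Applied to `g` and `g⁻¹` this gives order exactly `0`, that is `1 + m = 0`.
  have hle : ∀ f : W.FunctionFieldˣ,
      (∀ (x' y' : F) (hQ : W.Nonsingular x' y'), divisor W f (.some x' y' hQ) = 0) →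
        divisor W f 0 ≤ 0 := by
    intro f hf
    obtain ⟨r, hr⟩ := exists_algebraMap_eq W f.ne_zero fun x' y' hQ => (hf x' y' hQ).ge
    have hr0 : r ≠ 0 := by
      rintro rfl
      rw [map_zero] at hr
      exact f.ne_zero hr.symm
    rw [show f = toUnit r hr0 from Units.ext hr.symm, divisor_toUnit_zero, inftyDegree]
    lia
  have h1 := hle g hord
  have h2 := hle g⁻¹ fun x' y' hQ => by rw [divisor_inv, Finsupp.neg_apply, hord, neg_zero]
  rw [divisor_inv, Finsupp.neg_apply] at h2
  rw [h, Finsupp.single_eq_same] at h1 h2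
  lia

/-- Principal divisors have degree `0` and sum `0`. -/
theorem divisorDegree_divisor_and_divisorSum_divisor (g : W.FunctionFieldˣ) :
    divisorDegree (divisor W g) = 0 ∧ divisorSum (divisor W g) = 0 := by
  obtain ⟨f, hf⟩ := sub_single_mem_range (divisor W g)
  have h : divisor W (g / f.toMul) = Finsupp.single (divisorSum (divisor W g)) 1 +
      Finsupp.single 0 (divisorDegree (divisor W g) - 1) := by
    rw [divisor_div, show divisor W f.toMul = _ from hf]
    abel
  have := eq_zero_of_divisor_eq_single_add h
  exact ⟨by lia, this.1⟩

end

/-! ### Values of functions -/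

/-- The function `f` takes the value `c` at the place given by the order function `v`. -/
def HasValue {F K : Type*} [Field F] [Field K] [Algebra F K] (v : K → ℤ) (f : K) (c : F) : Prop :=
  OrderGE v 1 (f - algebraMap F K c)

namespace HasValue

variable {F K : Type*} [Field F] [Field K] [Algebra F K] {v : K → ℤ} (hv : IsOrder v)
  {f g : K} {c d : F}
include hv

theorem add (hf : HasValue v f c) (hg : HasValue v g d) : HasValue v (f + g) (c + d) := by
  have := hv.orderGE_add hf hg
  rwa [sub_add_sub_comm, ← map_add] at this

theorem sub (hf : HasValue v f c) (hg : HasValue v g d) : HasValue v (f - g) (c - d) := by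
  have := hv.orderGE_sub hf hg
  rwa [sub_sub_sub_comm, ← map_sub] at this

omit hv in
theorem const (c : F) : HasValue v (algebraMap F K c) c := fun h => absurd (sub_self _) h

theorem neg (hf : HasValue v f c) : HasValue v (-f) (-c) := by
  simpa using sub hv (const (0 : F)) hf

variable [IsAlgClosed F]

theorem orderGE_zero (hf : HasValue v f c) : OrderGE v 0 f := by
  have := hv.orderGE_add (n := 0) (fun h => zero_le_one.trans (hf h)) (hv.orderGE_algebraMap c)
  rwa [sub_add_cancel] at this

theorem mul (hf : HasValue v f c) (hg : HasValue v g d) : HasValue v (f * g) (c * d) := by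
  have := hv.orderGE_add (n := 1) (hv.orderGE_mul (orderGE_zero hv hf) hg)
    (hv.orderGE_mul (hv.orderGE_algebraMap d) hf)
  have e : f * g - algebraMap F K (c * d) = f * (g - algebraMap F K d) +
      algebraMap F K d * (f - algebraMap F K c) := by
    rw [map_mul]
    ring
  rwa [HasValue, e]

theorem ne_zero (hg : HasValue v g d) (hd : d ≠ 0) : g ≠ 0 ∧ v g = 0 := by
  have hd' : algebraMap F K d ≠ 0 := (_root_.map_ne_zero _).2 hd
  have h := hv.add_eq_left hd' (g := g - algebraMap F K d) (by rwa [hv.algebraMap_eq_zero hd])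
  rwa [add_sub_cancel, hv.algebraMap_eq_zero hd] at h

theorem inv (hg : HasValue v g d) (hd : d ≠ 0) : HasValue v g⁻¹ d⁻¹ := by
  obtain ⟨hg0, hvg⟩ := ne_zero hv hg hd
  have hd' : algebraMap F K d ≠ 0 := (_root_.map_ne_zero _).2 hd
  have e : g⁻¹ - algebraMap F K d⁻¹ = (algebraMap F K d⁻¹ * g⁻¹) * -(g - algebraMap F K d) := by
    rw [map_inv₀]
    field_simp
    ring
  rw [HasValue, e]
  have h1 : OrderGE v 0 g⁻¹ := fun _ => by rw [hv.inv hg0, hvg, neg_zero]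
  simpa using hv.orderGE_mul (hv.orderGE_mul (hv.orderGE_algebraMap d⁻¹) h1) (hv.orderGE_neg hg)

theorem div (hf : HasValue v f c) (hg : HasValue v g d) (hd : d ≠ 0) :
    HasValue v (f / g) (c / d) := by
  rw [div_eq_mul_inv, div_eq_mul_inv]
  exact mul hv hf (inv hv hg hd)

end HasValue

/-! ### Translations and divisors -/

section

variable {F : Type*} [Field F] [DecidableEq F] [IsAlgClosed F] {W : WeierstrassCurve.Affine F}
  [W.IsElliptic]

theorem isOrder_pointOrder_translation (s P : W.Point) :
    IsOrder fun f => pointOrder W P (translation W s f) :=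
  (isOrder_pointOrder W P).comp_ringEquiv (translation W s).toRingEquiv

theorem exists_pointOrder_translation_eq_one (s P : W.Point) :
    ∃ f ≠ 0, pointOrder W P (translation W s f) = 1 := by
  obtain ⟨f, hf, h⟩ := exists_pointOrder_eq_one W P
  exact ⟨(translation W s).symm f, by simpa using hf, by simpa using h⟩

/-- The addition formula for the generic point and a constant point. Only the chord case occurs, as
`x` is not a constant. -/
theorem translation_xFun_yFun {x y : F} (h : W.Nonsingular x y) :
    let k := algebraMap F W.FunctionField
    let l := (yFun W - k y) / (xFun W - k x)
    let z := l ^ 2 + k W.a₁ * l - k W.a₂ - xFun W - k x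
    translation W (.some x y h) (xFun W) = z ∧
      translation W (.some x y h) (yFun W) =
        -(l * (z - xFun W) + yFun W) - k W.a₁ * z - k W.a₃ := by
  classical
  intro k l z
  have hτ := map_translation_genericPoint W (.some x y h)
  have hne := xFun_ne_algebraMap W x
  have hk : (W⁄W.FunctionField).Nonsingular (k x) (k y) :=
    (W.map_nonsingular (algebraMap F W.FunctionField).injective x y).2 h
  have hconst : constPoint W (.some x y h) = .some (k x) (k y) hk := rfl
  rw [genericPoint, Point.map_some, hconst] at hτ
  replace hτ := hτ.trans (Point.add_of_X_ne hne)
  injection hτ with h1 h2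
  have hl : (W⁄W.FunctionField).slope (xFun W) (k x) (yFun W) (k y) = l := slope_of_X_ne hne
  rw [hl] at h1 h2
  exact ⟨h1, h2⟩

/-- When the `x`-coordinates differ, the denominator of the slope does not vanish at the point.
Hence `τ x` and `τ y` take there the coordinates of the sum as values, and these locate the center
of the transported order. -/
theorem pointOrder_translation_of_X_ne {x₀ y₀ x y : F} (h₀ : W.Nonsingular x₀ y₀)
    (h : W.Nonsingular x y) (hx : x₀ ≠ x) {f : W.FunctionField} (hf : f ≠ 0) :
    pointOrder W (.some x₀ y₀ h₀) (translation W (.some x y h) f) =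
      pointOrder W (.some x₀ y₀ h₀ + .some x y h) f := by
  have hv := isOrder_pointOrder W (.some x₀ y₀ h₀)
  set v := pointOrder W (.some x₀ y₀ h₀)
  have hx₀ : HasValue v (xFun W) x₀ := orderGE_xFun_sub W h₀
  have hy₀ : HasValue v (yFun W) y₀ := orderGE_yFun_sub W h₀
  obtain ⟨h1, h2⟩ := translation_xFun_yFun h
  have hk := fun c : F => HasValue.const (v := v) c
  have hl := ((hy₀.sub hv (hk y)).div hv (hx₀.sub hv (hk x)) (sub_ne_zero.2 hx))
  set l := (yFun W - algebraMap F _ y) / (xFun W - algebraMap F _ x)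
  have hz := (((((hl.mul hv hl).add hv ((hk W.a₁).mul hv hl)).sub hv (hk W.a₂)).sub hv hx₀).sub hv
    (hk x))
  rw [← pow_two, ← pow_two] at hz
  have hw := (((((hl.mul hv (hz.sub hv hx₀)).add hv hy₀).neg hv).sub hv ((hk W.a₁).mul hv hz)).sub hv
    (hk W.a₃))
  rw [← h1] at hz
  rw [← h2] at hw
  rw [Point.add_of_X_ne hx]
  refine eq_pointOrder_some W (isOrder_pointOrder_translation (.some x y h) (.some x₀ y₀ h₀))
    (fun c => (isOrder_pointOrder_translation (.some x y h) (.some x₀ y₀ h₀)).orderGE_algebraMap c)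
    (exists_pointOrder_translation_eq_one _ _) _ (fun h0 => ?_) (fun h0 => ?_) hf
  all_goals
    have h0' := (map_ne_zero_iff _ (translation W (.some x y h)).injective).2 h0
    beta_reduce
    rw [map_sub, AlgEquiv.commutes, slope_of_X_ne hx] at h0' ⊢
  · exact hz h0'
  · exact hw h0'

/-- The action of a translation on points, as determined by the order functions. -/
theorem exists_perm_pointOrder_translation (s : W.Point) :
    ∃ π : Equiv.Perm W.Point, ∀ P, ∀ f ≠ 0,
      pointOrder W P (translation W s f) = pointOrder W (π P) f := by
  choose π hπ using fun P => exists_eq_pointOrder (isOrder_pointOrder_translation s P)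
    (exists_pointOrder_translation_eq_one s P)
  refine ⟨Equiv.ofBijective π ⟨fun P Q hPQ => pointOrder_injective fun f hf => ?_, fun Q => ?_⟩, hπ⟩
  · have h0 : (translation W s).symm f ≠ 0 := by simpa using hf
    have hP := hπ P _ h0
    have hQ := hπ Q _ h0
    rw [AlgEquiv.apply_symm_apply] at hP hQ
    rw [hP, hQ, hPQ]
  · obtain ⟨P, hP⟩ := exists_eq_pointOrder
      ((isOrder_pointOrder W Q).comp_ringEquiv (translation W s).symm.toRingEquiv) <| by
        obtain ⟨f, hf, h⟩ := exists_pointOrder_eq_one W Q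
        exact ⟨translation W s f, by simpa using hf, by simpa using h⟩
    refine ⟨P, pointOrder_injective fun f hf => ?_⟩
    have h0 : translation W s f ≠ 0 := by simpa using hf
    rw [← hπ P f hf, ← hP _ h0]
    simp

/-- A permutation of the points that preserves principal divisors is affine. -/
theorem perm_add_of_pointOrder_translation {s : W.Point} {π : Equiv.Perm W.Point}
    (hπ : ∀ P, ∀ f ≠ 0, pointOrder W P (translation W s f) = pointOrder W (π P) f) (P Q : W.Point) :
    π (P + Q) + π 0 = π P + π Q := by
  obtain ⟨g, hg⟩ := exists_divisor_eq_single_add P Q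
  -- The function `τ⁻¹ g` has the divisor of `g` pushed forward along `π`; its sum must vanish,
  -- which is the claim.
  have h0 : (translation W s).symm g ≠ 0 := by simp
  have hdiv : divisor W (Units.mk0 _ h0) = (divisor W g).mapDomain π := by
    ext R
    obtain ⟨R, rfl⟩ := π.surjective R
    rw [Finsupp.mapDomain_apply π.injective, divisor_apply, divisor_apply, Units.val_mk0,
      ← hπ R _ h0, AlgEquiv.apply_symm_apply]
  have h1 := (divisorDegree_divisor_and_divisorSum_divisor (Units.mk0 _ h0)).2
  rw [hdiv, hg] at h1
  simp only [sub_eq_add_neg, ← Finsupp.single_neg, Finsupp.mapDomain_add, Finsupp.mapDomain_single,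
    map_add, divisorSum_single, one_zsmul, neg_zsmul] at h1
  refine (sub_eq_zero.1 (Eq.trans ?_ h1)).symm
  abel

/-- Translation by a point of infinite order shifts divisors: `ν_P(τ f) = ν_{P + s}(f)`. -/
theorem pointOrder_translation {s : W.Point} (hs : ¬ IsOfFinAddOrder s) (P : W.Point)
    {f : W.FunctionField} (hf : f ≠ 0) :
    pointOrder W P (translation W s f) = pointOrder W (P + s) f := by
  obtain ⟨π, hπ⟩ := exists_perm_pointOrder_translation s
  rw [hπ P f hf]
  congr 1
  have hs0 : s ≠ 0 := by rintro rfl; exact hs IsOfFinAddOrder.zero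
  -- Affine points have equal `x`-coordinates only if they are equal or opposite, so the addition
  -- formula covers all these `P`.
  have hgen : ∀ P : W.Point, P ≠ 0 → P ≠ s → P ≠ -s → π P = P + s := by
    intro P h0 h1 h2
    refine pointOrder_injective fun f hf => ?_
    rw [← hπ P f hf]
    rcases P with _ | ⟨x₀, y₀, h₀⟩
    · exact absurd rfl h0
    rcases s with _ | ⟨x, y, h⟩
    · exact absurd rfl hs0
    refine pointOrder_translation_of_X_ne h₀ h (fun hx => ?_) hf
    rcases Point.X_eq_iff.1 hx with h | h
    exacts [h1 h, h2 h]
  have hinj : Function.Injective fun n : ℕ => n • s := injective_nsmul_iff_not_isOfFinAddOrder.2 hs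
  have hex : ∀ P : W.Point, ∃ Q, π Q = Q + s ∧ π (P + Q) = P + Q + s := by
    intro P
    -- The six exclusions keep both `Q = n • s` and `P + Q` away from `0, s, -s`; infinitely many
    -- multiples of `s` remain available.
    obtain ⟨n, hn⟩ : ∃ n : ℕ, n • s ∉ ({0, s, -s, -P, s - P, -s - P} : Finset W.Point) := by
      set T : Finset W.Point := {0, s, -s, -P, s - P, -s - P}
      by_contra! hall
      exact Set.infinite_univ ((T.finite_toSet.preimage hinj.injOn).subset fun n _ => hall n)
    simp only [Finset.mem_insert, Finset.mem_singleton, not_or] at hn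
    obtain ⟨n0, n1, n2, n3, n4, n5⟩ := hn
    exact ⟨n • s, hgen _ n0 n1 n2, hgen _ (fun h => n3 (eq_neg_of_add_eq_zero_right h))
      (fun h => n4 (eq_sub_of_add_eq' h)) (fun h => n5 (eq_sub_of_add_eq' h))⟩
  -- Both `π Q` and `π (P + Q)` are known, so affinity determines `π P` up to `π 0`. Any good `Q`
  -- then gives `π 0 = s`.
  have hadd : ∀ P, π P = P + π 0 := by
    intro P
    obtain ⟨Q, h1, h2⟩ := hex P
    have h3 := perm_add_of_pointOrder_translation hπ P Q
    rw [h1, h2] at h3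
    have h4 : P + π 0 + (Q + s) = π P + (Q + s) := by
      rw [← h3]
      abel
    exact (add_right_cancel h4).symm
  obtain ⟨Q, h1, _⟩ := hex 0
  rw [hadd P, add_left_cancel ((hadd Q).symm.trans h1)]

end

/-! ### Divisors and orbits of a translation -/

section Orbits

variable {G : Type*} [AddCommGroup G] {s : G}

/-- The translate of a divisor: `shift s D P = D (P + s)`. -/
noncomputable def shift (s : G) : (G →₀ ℤ) →+ (G →₀ ℤ) :=
  Finsupp.mapDomain.addMonoidHom fun P => P - s

theorem shift_single (P : G) (n : ℤ) : shift s (.single P n) = .single (P - s) n :=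
  Finsupp.mapDomain_single

theorem shift_apply (D : G →₀ ℤ) (P : G) : shift s D P = D (P + s) := by
  have h := Finsupp.mapDomain_apply (sub_left_injective (b := s)) D (P + s)
  rwa [add_sub_cancel_right] at h

/-- Read with `f` the quotient map, condition (1) says that the divisor pushes forward to `0` on the
set of orbits. -/
theorem mapDomain_apply_eq_finsum {A B : Type*} (f : A → B) (D : A →₀ ℤ) (b : B) :
    D.mapDomain f b = ∑ᶠ a ∈ {a | f a = b}, D a := by
  classical
  rw [finsum_mem_eq_sum_filter _ _ D.hasFiniteSupport, Finsupp.mapDomain, Finsupp.sum_apply,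
    Finsupp.sum, Finset.sum_filter]
  refine Finset.sum_congr (by ext; simp) fun a _ => ?_
  rw [Finsupp.single_apply]
  rfl

variable (hs : ¬ IsOfFinAddOrder s) {α : G ⧸ AddSubgroup.zmultiples s → G}
  (hα : ∀ ω, (QuotientAddGroup.mk (α ω) : G ⧸ AddSubgroup.zmultiples s) = ω)

theorem mk_add_zsmul (P : G) (n : ℤ) :
    (QuotientAddGroup.mk (P + n • s) : G ⧸ AddSubgroup.zmultiples s) = QuotientAddGroup.mk P := by
  rw [eq_comm, QuotientAddGroup.eq, neg_add_cancel_left]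
  exact ⟨n, rfl⟩

/-- The coordinates on `G` given by representatives of the orbits of the translation by `s`. -/
noncomputable def orbitEquiv : (G ⧸ AddSubgroup.zmultiples s) × ℤ ≃ G :=
  Equiv.ofBijective (fun p => α p.1 + p.2 • s) <| by
    constructor
    · rintro ⟨ω, n⟩ ⟨ω', n'⟩ h
      have h' := congrArg (QuotientAddGroup.mk (s := AddSubgroup.zmultiples s)) h
      simp only [mk_add_zsmul, hα] at h'
      subst h'
      exact Prod.ext rfl (injective_zsmul_iff_not_isOfFinAddOrder.2 hs (add_left_cancel h))
    · intro P
      obtain ⟨n, hn⟩ := QuotientAddGroup.eq.1 (hα (QuotientAddGroup.mk P))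
      exact ⟨(QuotientAddGroup.mk P, n), by
        change _ + n • s = P
        rw [show n • s = -α (QuotientAddGroup.mk P) + P from hn, add_neg_cancel_left]⟩

theorem orbitEquiv_apply (ω : G ⧸ AddSubgroup.zmultiples s) (n : ℤ) :
    orbitEquiv hs hα (ω, n) = α ω + n • s := rfl

/-- The sum of an additive function of the coefficients of a divisor, in terms of orbits. -/
theorem finsum_orbits {M : Type*} [AddCommMonoid M]
    (φ : (G ⧸ AddSubgroup.zmultiples s) × ℤ → ℤ →+ M) (D : G →₀ ℤ) :
    ∑ᶠ ω, ∑ᶠ n : ℤ, φ (ω, n) (D (α ω + n • s)) =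
      Finsupp.liftAddHom (fun P => φ ((orbitEquiv hs hα).symm P)) D := by
  set e := orbitEquiv hs hα
  have hsupp : (Function.support fun P => φ (e.symm P) (D P)) ⊆ D.support := by
    intro P hP
    rw [Finset.mem_coe, Finsupp.mem_support_iff]
    intro h0
    exact hP (by simp only [h0, map_zero])
  have hfin : (Function.support fun p => φ p (D (e p))).Finite := by
    refine ((D.hasFiniteSupport).preimage e.injective.injOn).subset fun p hp => ?_
    rw [Set.mem_preimage, Function.mem_support]
    intro h0
    exact hp (by simp only [h0, map_zero])
  rw [Finsupp.liftAddHom_apply, Finsupp.sum, ← finsum_eq_sum_of_support_subset _ hsupp,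
    ← finsum_comp_equiv e]
  simp only [Equiv.symm_apply_apply]
  exact (finsum_curry _ hfin).symm

/-- The orbit sum `∑ n · D(α ω + n s)`. -/
noncomputable def orbitMoment : (G →₀ ℤ) →+ ℤ :=
  Finsupp.liftAddHom fun P => AddMonoidHom.mulLeft ((orbitEquiv hs hα).symm P).2

/-- The orbit sum `∑ n D(α ω + n s) α ω + ∑ n (n + 1) / 2 D(α ω + n s) s`. -/
noncomputable def orbitSum : (G →₀ ℤ) →+ G :=
  (Finsupp.liftAddHom fun P => (zmultiplesHom G (α ((orbitEquiv hs hα).symm P).1)).comp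
      (AddMonoidHom.mulLeft ((orbitEquiv hs hα).symm P).2)) +
    Finsupp.liftAddHom fun P => (zmultiplesHom G s).comp (AddMonoidHom.mulLeft
      (((orbitEquiv hs hα).symm P).2 * (((orbitEquiv hs hα).symm P).2 + 1) / 2))

theorem orbitMoment_eq_finsum (D : G →₀ ℤ) :
    ∑ᶠ ω, ∑ᶠ n : ℤ, n * D (α ω + n • s) = orbitMoment hs hα D :=
  finsum_orbits hs hα (fun p => AddMonoidHom.mulLeft p.2) D

theorem orbitSum_eq_finsum (D : G →₀ ℤ) :
    (∑ᶠ ω, ∑ᶠ n : ℤ, (n * D (α ω + n • s)) • α ω) +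
      (∑ᶠ ω : G ⧸ AddSubgroup.zmultiples s, ∑ᶠ n : ℤ,
        (n * (n + 1) / 2 * D (α ω + n • s)) • s) = orbitSum hs hα D :=
  congrArg₂ (· + ·)
    (finsum_orbits hs hα (fun p => (zmultiplesHom G (α p.1)).comp (AddMonoidHom.mulLeft p.2)) D)
    (finsum_orbits hs hα
      (fun p => (zmultiplesHom G s).comp (AddMonoidHom.mulLeft (p.2 * (p.2 + 1) / 2))) D)

/-- On a single point with coordinate `n` the shift changes the weight from `n` to `n - 1`, whatever
the orbit. -/
theorem orbitMoment_shift_sub (D : G →₀ ℤ) :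
    orbitMoment hs hα (shift s D - D) = -divisorDegree D := by
  induction D using Finsupp.induction_linear with
  | zero => simp
  | add D E hD hE =>
    rw [map_add, map_add, add_sub_add_comm, map_add, hD, hE]
    abel
  | single P m =>
    obtain ⟨⟨ω, n⟩, rfl⟩ := (orbitEquiv hs hα).surjective P
    have h : orbitEquiv hs hα (ω, n) - s = orbitEquiv hs hα (ω, n - 1) := by
      rw [orbitEquiv_apply, orbitEquiv_apply, sub_zsmul, one_zsmul]
      abel
    rw [shift_single, h, map_sub, orbitMoment, divisorDegree_single]
    simp only [Finsupp.liftAddHom_apply_single, Equiv.symm_apply_apply, AddMonoidHom.coe_mulLeft]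
    ring

/-- Going from `n` to `n - 1` lowers `n • α ω` by `α ω` and the triangular multiple of `s` by `n •
s`. Together this is `α ω + n • s`, the point itself; hence the weight `n(n+1)/2`. -/
theorem orbitSum_shift_sub (D : G →₀ ℤ) :
    orbitSum hs hα (shift s D - D) = -divisorSum D := by
  induction D using Finsupp.induction_linear with
  | zero => simp
  | add D E hD hE =>
    rw [map_add, map_add, add_sub_add_comm, map_add, hD, hE]
    abel
  | single P m =>
    obtain ⟨⟨ω, n⟩, rfl⟩ := (orbitEquiv hs hα).surjective P
    have h : orbitEquiv hs hα (ω, n) - s = orbitEquiv hs hα (ω, n - 1) := by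
      rw [orbitEquiv_apply, orbitEquiv_apply, sub_zsmul, one_zsmul]
      abel
    -- The increment `2n` is even, so integer division splits without a parity discussion.
    have h2 : n * (n + 1) / 2 = (n - 1) * (n - 1 + 1) / 2 + n := by
      rw [show n * (n + 1) = (n - 1) * (n - 1 + 1) + n * 2 by ring,
        Int.add_mul_ediv_right _ _ two_ne_zero]
    rw [shift_single, h, map_sub, orbitSum, divisorSum_single]
    simp only [AddMonoidHom.add_apply, Finsupp.liftAddHom_apply_single, Equiv.symm_apply_apply,
      AddMonoidHom.comp_apply, AddMonoidHom.coe_mulLeft, zmultiplesHom_apply, h2]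
    rw [orbitEquiv_apply, sub_mul, add_mul, sub_zsmul, add_zsmul, one_mul, zsmul_add, smul_smul,
      mul_comm m n]
    abel

include hα in
/-- A divisor with sum zero along all orbits is a difference of translates. -/
theorem exists_eq_shift_sub {D : G →₀ ℤ}
    (h : D.mapDomain (QuotientAddGroup.mk (s := AddSubgroup.zmultiples s)) = 0) :
    ∃ E, shift s E - E = D := by
  -- Modulo the image of `T`, each point may be moved along its orbit to the representative. Hence
  -- `D` is congruent to its orbit sums placed at the representatives, which vanish.
  let T : (G →₀ ℤ) →+ (G →₀ ℤ) := shift s - AddMonoidHom.id _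
  have hstep : ∀ (P : G) (m : ℤ),
      Finsupp.single (P + s) m - Finsupp.single P m ∈ T.range := by
    intro P m
    refine ⟨-Finsupp.single (P + s) m, ?_⟩
    simp only [T, AddMonoidHom.sub_apply, map_neg, AddMonoidHom.id_apply, shift_single,
      add_sub_cancel_right]
    abel
  have hzsmul : ∀ (P : G) (n m : ℤ),
      Finsupp.single (P + n • s) m - Finsupp.single P m ∈ T.range := by
    intro P n m
    induction n using Int.induction_on with
    | zero => simp
    | succ n ih =>
      convert add_mem ih (hstep (P + (n : ℤ) • s) m) using 1
      rw [add_zsmul, one_zsmul, add_assoc]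
      abel
    | pred n ih =>
      convert sub_mem ih (hstep (P + (-(n : ℤ) - 1) • s) m) using 1
      rw [add_assoc, ← add_one_zsmul, sub_add_cancel]
      abel
  have key : ∀ D : G →₀ ℤ,
      D - (D.mapDomain (QuotientAddGroup.mk (s := AddSubgroup.zmultiples s))).mapDomain α ∈
        T.range := by
    intro D
    induction D using Finsupp.induction_linear with
    | zero => simp
    | add D E hD hE =>
      rw [Finsupp.mapDomain_add, Finsupp.mapDomain_add, add_sub_add_comm]
      exact add_mem hD hE
    | single P m =>
      rw [Finsupp.mapDomain_single, Finsupp.mapDomain_single]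
      obtain ⟨n, hn⟩ := QuotientAddGroup.eq.1 (hα (QuotientAddGroup.mk P))
      have := hzsmul (α (QuotientAddGroup.mk P)) n m
      rwa [show n • s = -α (QuotientAddGroup.mk P) + P from hn, add_neg_cancel_left] at this
  have hD := key D
  rw [h, Finsupp.mapDomain_zero, sub_zero] at hD
  exact hD

theorem mapDomain_mk_shift_sub (D : G →₀ ℤ) :
    (shift s D - D).mapDomain (QuotientAddGroup.mk (s := AddSubgroup.zmultiples s)) = 0 := by
  have h : (shift s D).mapDomain (QuotientAddGroup.mk (s := AddSubgroup.zmultiples s)) =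
      D.mapDomain (QuotientAddGroup.mk (s := AddSubgroup.zmultiples s)) := by
    refine (Finsupp.mapDomain_comp (v := D)).symm.trans (Finsupp.mapDomain_congr fun P _ => ?_)
    have := mk_add_zsmul (s := s) P (-1)
    rwa [neg_one_zsmul, ← sub_eq_add_neg] at this
  have hsub := map_sub (Finsupp.mapDomain.addMonoidHom (M := ℤ)
    (QuotientAddGroup.mk (s := AddSubgroup.zmultiples s))) (shift s D) D
  exact hsub.trans (sub_eq_zero.2 h)

/-- The divisors `E(P + s) - E(P)` with `E` of degree `0` and sum `0`. -/
theorem exists_shift_sub_iff (D : G →₀ ℤ) :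
    (∃ E, divisorDegree E = 0 ∧ divisorSum E = 0 ∧ shift s E - E = D) ↔
      (∀ ω : G ⧸ AddSubgroup.zmultiples s,
        ∑ᶠ P ∈ {P : G | (QuotientAddGroup.mk P : G ⧸ AddSubgroup.zmultiples s) = ω}, D P = 0) ∧
      orbitMoment hs hα D = 0 ∧ orbitSum hs hα D = 0 := by
  simp only [← mapDomain_apply_eq_finsum]
  constructor
  · rintro ⟨E, hdeg, hsum, rfl⟩
    rw [mapDomain_mk_shift_sub, orbitMoment_shift_sub, orbitSum_shift_sub, hdeg, hsum]
    simp
  · rintro ⟨h1, h2, h3⟩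
    -- Whichever `E` is found, its degree and sum are read off from `D`, so the other two conditions
    -- apply to it.
    obtain ⟨E, rfl⟩ := exists_eq_shift_sub hα (Finsupp.ext h1)
    rw [orbitMoment_shift_sub, neg_eq_zero] at h2
    rw [orbitSum_shift_sub, neg_eq_zero] at h3
    exact ⟨E, h2, h3, rfl⟩

end Orbits

/-! ### From functions to divisors -/

section

variable {F : Type*} [Field F] [DecidableEq F] [IsAlgClosed F] {W : WeierstrassCurve.Affine F}
  [W.IsElliptic]

/-- The automorphism of the group of nonzero functions induced by a translation. -/
noncomputable def translationUnits (s : W.Point) : W.FunctionFieldˣ →* W.FunctionFieldˣ :=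
  Units.map (translation W s : W.FunctionField →* W.FunctionField)

theorem divisor_translationUnits {s : W.Point} (hs : ¬ IsOfFinAddOrder s) (r : W.FunctionFieldˣ) :
    divisor W (translationUnits s r) = shift s (divisor W r) :=
  Finsupp.ext fun P => by
    rw [shift_apply]
    exact pointOrder_translation hs P r.ne_zero

omit [DecidableEq F] [W.IsElliptic] in
theorem divisor_const (c : Fˣ) :
    divisor W (Units.map (algebraMap F W.FunctionField : F →* W.FunctionField) c) = 0 :=
  Finsupp.ext fun _ => pointOrder_algebraMap c.ne_zero

/-- Taking divisors loses only constants, which `c` absorbs, and the divisors of functions `r` are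
exactly those of degree `0` and sum `0`. -/
theorem exists_eq_const_mul_translation_iff {s : W.Point} (hs : ¬ IsOfFinAddOrder s)
    (a : W.FunctionFieldˣ) :
    (∃ (r : W.FunctionFieldˣ) (c : Fˣ), (a : W.FunctionField) =
        algebraMap F W.FunctionField c * (translation W s r / r)) ↔
      ∃ E, divisorDegree E = 0 ∧ divisorSum E = 0 ∧ shift s E - E = divisor W a := by
  constructor
  · rintro ⟨r, c, h⟩
    have ha : a = Units.map (algebraMap F W.FunctionField : F →* W.FunctionField) c *
        (translationUnits s r / r) := Units.ext (by rw [h]; simp [translationUnits])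
    obtain ⟨hdeg, hsum⟩ := divisorDegree_divisor_and_divisorSum_divisor r
    refine ⟨divisor W r, hdeg, hsum, ?_⟩
    rw [ha, divisor_mul, divisor_div, divisor_const, divisor_translationUnits hs, zero_add]
  · rintro ⟨E, hdeg, hsum, h⟩
    obtain ⟨r, rfl⟩ := exists_divisor_eq hdeg hsum
    have h0 : divisor W (a / (translationUnits s r / r)) = 0 := by
      rw [divisor_div, divisor_div, divisor_translationUnits hs, h, sub_self]
    obtain ⟨c, hc⟩ := exists_eq_const_of_divisor_eq_zero h0
    refine ⟨r, c, ?_⟩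
    rw [hc]
    have : (translationUnits s r : W.FunctionField) = translation W s r := rfl
    rw [← this, ← Units.val_div_eq_div_val, ← Units.val_mul, div_mul_cancel]

end

end EllipticFunctions

theorem mainTheorem8 {F : Type*} [Field F] [DecidableEq F] [IsAlgClosed F]
    (W : WeierstrassCurve.Affine F) [W.IsElliptic]
    (s : W.Point) (hs : ¬ IsOfFinAddOrder s)
    (α : W.Point ⧸ AddSubgroup.zmultiples s → W.Point)
    (hα : ∀ ω, (QuotientAddGroup.mk (α ω) : W.Point ⧸ AddSubgroup.zmultiples s) = ω)
    (a : W.FunctionFieldˣ) :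
    (∃ (r : W.FunctionFieldˣ) (c : Fˣ), (a : W.FunctionField) =
        algebraMap F W.FunctionField c * (EllipticFunctions.translation W s r / r)) ↔
      (∀ ω : W.Point ⧸ AddSubgroup.zmultiples s,
          ∑ᶠ P ∈ {P : W.Point | (QuotientAddGroup.mk P : W.Point ⧸ AddSubgroup.zmultiples s) = ω},
            EllipticFunctions.divisor W a P = 0) ∧
      (∑ᶠ ω : W.Point ⧸ AddSubgroup.zmultiples s, ∑ᶠ n : ℤ,
          n * EllipticFunctions.divisor W a (α ω + n • s) = 0) ∧
      (∑ᶠ ω : W.Point ⧸ AddSubgroup.zmultiples s, ∑ᶠ n : ℤ,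
            (n * EllipticFunctions.divisor W a (α ω + n • s)) • α ω) +
          (∑ᶠ ω : W.Point ⧸ AddSubgroup.zmultiples s, ∑ᶠ n : ℤ,
            (n * (n + 1) / 2 * EllipticFunctions.divisor W a (α ω + n • s)) • s) = 0 := by
  rw [EllipticFunctions.exists_eq_const_mul_translation_iff hs,
    EllipticFunctions.exists_shift_sub_iff hs hα, EllipticFunctions.orbitMoment_eq_finsum hs hα,
    EllipticFunctions.orbitSum_eq_finsum hs hα]
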